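/- **Proposition 4.2.** For $m\ge -1$ let $[m]=\{0<\dots<m\}$ (with $[-1]=\emptyset$), and let ${}_+\bar\Delta$ be the category with objects $[m]$, $m\ge -1$, and the strictly increasing maps as morphisms. For a small category $C$, let $\mathsf{DK}(C)$ be its free resolution: the simplicial category with $\mathsf{DK}(C)_n=(FU)^{n+1}C$ given by the comonad $FU$, where $U$ is the forgetful functor from small categories to reflexive directed graphs and $F$ is its left adjoint (so $FU\,C$ is the free category generated by the non-identity morphisms of $C$). It is augmented over $C$ by the iterated counit. Let $j,m\ge -1$. 1. The simplicial mapping space $\mathsf{DK}({}_+\bar\Delta^{\rm op})([j],[m])$ is the disjoint union $\coprod_{\theta}C_\theta$ over the morphisms $\theta\colon[j]\to[m]$ of ${}_+\bar\Delta^{\rm op}$ of the simplicial subsets $C_\theta$ of simplices lying over $\theta$. 2. Let $\theta\colon[j]\to[m]$ be a morphism of ${}_+\bar\Delta^{\rm op}$, that is, an injection $[m]\to[j]$ of ordered sets, and identify the complement of its image with $\{0,\dots,j-m-1\}$ by the order isomorphism. The vertices of $C_\theta$ are the factorizations $\theta=\theta_k\circ\dots\circ\theta_1$, $k\ge 0$,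 into non-identity morphisms. These are in bijection with the ordered partitions of $\{0,\dots,j-m-1\}$ into $k$ nonempty blocks $(S_1,\dots,S_k)$: the block $S_i$ consists of the elements that lie in the image of the injection given by $\theta_{k-i}\circ\dots\circ\theta_1$ but not in that of $\theta_{k-i+1}\circ\dots\circ\theta_1$. 3. Let $x_0,\dots,x_{j-m-1}$ be any distinct real numbers, and let $\mathbf P^{j-m-1}\subset\mathbb R^{j-m}$ be the $(j-m-1)$-dimensional permutahedron, the convex hull of the $(j-m)!$ points obtained by permuting the coordinates of $(x_0,\dots,x_{j-m-1})$. (For $j=m$ it is a point.) The nonempty faces of $\mathbf P^{j-m-1}$, including $\mathbf P^{j-m-1}$ itself, are in bijection with the ordered partitions of $\{0,\dots,j-m-1\}$: to $(S_1,\dots,S_k)$ corresponds the convex hull of those vertices whose coordinates at elements of $S_a$ are smaller than those at elements of $S_b$ whenever $a<b$; it has dimension $j-m-k$. 4. Each $C_\theta$ is a triangulation of $\mathbf P^{j-m-1}$: there is a homeomorphism $|C_\theta|\cong\mathbf P^{j-m-1}$ that is affine on each simplex and injective on each nondegenerate simplex. It can be chosen so that each vertex of $C_\theta$ is sent to the barycentre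 (the mean of the vertices) of the face corresponding to it under 2 and 3; and for every simplex of $C_\theta$, with vertices $v_0,\dots,v_n$ in order, the corresponding faces form a decreasing flag $F_{v_0}\supseteq\dots\supseteq F_{v_n}$. -/

import Mathlib

open CategoryTheory Opposite

/-! ### The restricted augmented simplex category -/

/-- Objects of the restricted augmented simplex category: the finite ordinals.  The object with
`card = k` is the ordered set `Fin k`, that is `[k - 1] = {0 < ... < k - 1}`; the object with
`card = 0` is `[-1]`, the empty ordered set. -/
structure PlusDelta : Type where
  /-- the number of elements; the usual name of the object is `[card - 1]` -/
  card : ℕ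

/-- Morphisms are the monomorphisms of ordered sets, i.e. the strictly increasing maps. -/
instance PlusDelta.category : Category.{0} PlusDelta where
  Hom a b := Fin a.card ↪o Fin b.card
  id a := RelEmbedding.refl _
  comp f g := RelEmbedding.trans f g

/-- The underlying strictly increasing map of a morphism. -/
def PlusDelta.emb {a b : PlusDelta} (f : a ⟶ b) : Fin a.card ↪o Fin b.card := f

/-! ### The simplicial resolution attached to a comonad -/

section Bar

variable {D : Type*} [Category D] (G : Comonad D) (X : D)

/-- The iterates `G (G (... (G X)))` with `n` letters `G`. -/
def comonadIter : ℕ → D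
  | 0 => X
  | n + 1 => G.toFunctor.obj (comonadIter n)

/-- The counit at the outermost letter. -/
def comonadCounit (m : ℕ) : comonadIter G X (m + 1) ⟶ comonadIter G X m :=
  G.ε.app (comonadIter G X m)

/-- The comultiplication at the outermost letter. -/
def comonadComul (m : ℕ) : comonadIter G X (m + 1) ⟶ comonadIter G X (m + 2) :=
  G.δ.app (comonadIter G X m)

variable {X} in
/-- Application of `G` to a morphism between iterates. -/
def comonadApply {n m : ℕ} (φ : comonadIter G X n ⟶ comonadIter G X m) :
    comonadIter G X (n + 1) ⟶ comonadIter G X (m + 1) :=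
  G.toFunctor.map φ

theorem comonadApply_id (n : ℕ) : comonadApply G (𝟙 (comonadIter G X n)) = 𝟙 _ :=
  G.toFunctor.map_id _

theorem comonadApply_comp {n m k : ℕ} (φ : comonadIter G X n ⟶ comonadIter G X m)
    (ψ : comonadIter G X m ⟶ comonadIter G X k) :
    comonadApply G (φ ≫ ψ) = comonadApply G φ ≫ comonadApply G ψ :=
  G.toFunctor.map_comp _ _

theorem comonadCounit_naturality {n m : ℕ} (φ : comonadIter G X n ⟶ comonadIter G X m) :
    comonadApply G φ ≫ comonadCounit G X m = comonadCounit G X n ≫ φ :=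
  G.ε.naturality φ

theorem comonadComul_naturality {n m : ℕ} (φ : comonadIter G X n ⟶ comonadIter G X m) :
    comonadApply G φ ≫ comonadComul G X m =
      comonadComul G X n ≫ comonadApply G (comonadApply G φ) :=
  G.δ.naturality φ

theorem comonadComul_coassoc (m : ℕ) :
    comonadComul G X m ≫ comonadApply G (comonadComul G X m) =
      comonadComul G X m ≫ comonadComul G X (m + 1) :=
  G.coassoc _

theorem comonadComul_counit (m : ℕ) :
    comonadComul G X m ≫ comonadCounit G X (m + 1) = 𝟙 _ :=
  G.left_counit _

theorem comonadComul_apply_counit (m : ℕ) :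
    comonadComul G X m ≫ comonadApply G (comonadCounit G X m) = 𝟙 _ :=
  G.right_counit _

/-- `i ↦ f (i + 1)`. -/
def monoTail {n m : ℕ} (f : Fin (n + 1) →o Fin m) : Fin n →o Fin m where
  toFun i := f i.succ
  monotone' _ _ h := f.monotone (Fin.succ_le_succ_iff.mpr h)

theorem mono_ne_zero {n m : ℕ} (f : Fin (n + 1) →o Fin (m + 1)) (h : f 0 ≠ 0)
    (i : Fin (n + 1)) : f i ≠ 0 := fun hi =>
  h (le_antisymm (hi ▸ f.monotone (Fin.zero_le i)) (Fin.zero_le _))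

/-- `i ↦ f i - 1`, when `f` does not take the value `0`. -/
def monoPred {n m : ℕ} (f : Fin (n + 1) →o Fin (m + 1)) (h : f 0 ≠ 0) :
    Fin (n + 1) →o Fin m where
  toFun i := (f i).pred (mono_ne_zero f h i)
  monotone' _ _ hij := Fin.pred_le_pred_iff.mpr (f.monotone hij)

/-- The unique map out of the empty ordinal. -/
def monoEmpty (m : ℕ) : Fin 0 →o Fin m where
  toFun i := i.elim0
  monotone' i := i.elim0

/-- The structure map `G ^ m X ⟶ G ^ n X` of the standard (co)augmented resolution of `X` attached
to a monotone map `f : Fin n → Fin m`.  The letters of `G ^ m` are numbered from the outside; the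
`i`-th letter is replaced by as many letters as the fibre `f ⁻¹ {i}` has elements, by means of the
counit (no letter), the identity (one letter) and the iterated comultiplication.
For the `i`-th coface map this is `G ^ i (ε _)`, and for the `i`-th codegeneracy `G ^ i (δ _)`. -/
def barMap : (n m : ℕ) → (Fin n →o Fin m) → (comonadIter G X m ⟶ comonadIter G X n)
  | 0, 0, _ => 𝟙 _
  | 0, m + 1, _ => comonadCounit G X m ≫ barMap 0 m (monoEmpty m)
  | _ + 1, 0, f => (f 0).elim0
  | n + 1, m + 1, f =>
    if h : f 0 = 0 then
      comonadComul G X m ≫ comonadApply G (barMap n (m + 1) (monoTail f))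
    else comonadCounit G X m ≫ barMap (n + 1) m (monoPred f h)
termination_by n m => n + m

theorem barMap_zero_succ (m : ℕ) (f : Fin 0 →o Fin (m + 1)) :
    barMap G X 0 (m + 1) f = comonadCounit G X m ≫ barMap G X 0 m (monoEmpty m) := by
  rw [barMap]

theorem barMap_of_eq {n m : ℕ} (f : Fin (n + 1) →o Fin (m + 1)) (h : f 0 = 0) :
    barMap G X (n + 1) (m + 1) f =
      comonadComul G X m ≫ comonadApply G (barMap G X n (m + 1) (monoTail f)) := by
  rw [barMap, dif_pos h]

theorem barMap_of_ne {n m : ℕ} (f : Fin (n + 1) →o Fin (m + 1)) (h : f 0 ≠ 0) :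
    barMap G X (n + 1) (m + 1) f =
      comonadCounit G X m ≫ barMap G X (n + 1) m (monoPred f h) := by
  rw [barMap, dif_neg h]

theorem barMap_of_pred {n m : ℕ} (f : Fin n →o Fin (m + 1)) (g : Fin n →o Fin m)
    (hg : ∀ i, f i = (g i).succ) :
    barMap G X n (m + 1) f = comonadCounit G X m ≫ barMap G X n m g := by
  cases n with
  | zero =>
    rw [barMap_zero_succ]
    congr 2
    ext i
    exact i.elim0
  | succ n =>
    have h : f 0 ≠ 0 := by rw [hg]; exact Fin.succ_ne_zero _
    rw [barMap_of_ne G X f h]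
    congr 2
    ext i
    simp [monoPred, hg]

theorem barMap_id (n : ℕ) : barMap G X n n OrderHom.id = 𝟙 _ := by
  induction n with
  | zero => rw [barMap]
  | succ n ih =>
    rw [barMap_of_eq G X _ rfl, barMap_of_pred G X (monoTail OrderHom.id) OrderHom.id
      (fun _ => rfl), ih, Category.comp_id, comonadComul_apply_counit]

theorem barMap_comp (k n m : ℕ) (g : Fin k →o Fin n) (f : Fin n →o Fin m) :
    barMap G X n m f ≫ barMap G X k n g = barMap G X k m (f.comp g) := by
  induction hs : k + n + m using Nat.strong_induction_on generalizing k n m with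
  | _ s ih =>
  subst hs
  cases m with
  | zero =>
    cases n with
    | zero =>
      have h : f = OrderHom.id := by ext i; exact i.elim0
      subst h
      rw [barMap_id, Category.id_comp]
      rfl
    | succ n => exact (f 0).elim0
  | succ m =>
    cases n with
    | zero =>
      rw [barMap_zero_succ, Category.assoc, ih _ (by omega) k 0 m g (monoEmpty m) rfl]
      exact (barMap_of_pred G X _ _ (fun i => (g i).elim0)).symm
    | succ n =>
      by_cases hf : f 0 = 0
      · cases k with
        | zero =>
          rw [barMap_zero_succ, barMap_of_eq G X f hf, Category.assoc,
            ← Category.assoc (comonadApply G _), comonadCounit_naturality, Category.assoc,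
            ← Category.assoc, comonadComul_counit, Category.id_comp,
            ih _ (by omega) 0 n (m + 1) (monoEmpty n) (monoTail f) rfl]
          congr 1
          ext i
          exact i.elim0
        | succ k =>
          by_cases hg : g 0 = 0
          · have hfg : (f.comp g) 0 = 0 := by simp [hg, hf]
            have h1 := ih _ (by omega) k (n + 1) (m + 1) (monoTail g) f rfl
            rw [barMap_of_eq G X f hf, Category.assoc] at h1
            rw [barMap_of_eq G X _ hfg, barMap_of_eq G X g hg, barMap_of_eq G X f hf,
              Category.assoc, ← Category.assoc (comonadApply G _), comonadComul_naturality,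
              Category.assoc, ← Category.assoc, ← comonadComul_coassoc, Category.assoc,
              ← comonadApply_comp, ← comonadApply_comp, h1]
            rfl
          · rw [barMap_of_ne G X g hg, barMap_of_eq G X f hf, Category.assoc,
              ← Category.assoc (comonadApply G _), comonadCounit_naturality, Category.assoc,
              ← Category.assoc, comonadComul_counit, Category.id_comp,
              ih _ (by omega) (k + 1) n (m + 1) (monoPred g hg) (monoTail f) rfl]
            congr 1
            ext i
            exact congrArg (fun j => (f j : ℕ)) (Fin.succ_pred _ (mono_ne_zero g hg i))
      · rw [barMap_of_ne G X f hf, Category.assoc,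
          ih _ (by omega) k (n + 1) m g (monoPred f hf) rfl]
        exact (barMap_of_pred G X _ _ (fun i => (Fin.succ_pred _ (mono_ne_zero f hf (g i))).symm)).symm

/-- The simplicial resolution of `X` attached to a comonad `G`: its `n`-th object is
`G ^ (n + 1) X`. -/
def comonadResolution : SimplicialObject D where
  obj n := comonadIter G X (n.unop.len + 1)
  map f := barMap G X _ _ f.unop.toOrderHom
  map_id _ := barMap_id G X _
  map_comp f g := (barMap_comp G X _ _ _ g.unop.toOrderHom f.unop.toOrderHom).symm

/-- The augmentation `G ^ (n + 1) X ⟶ X` of the resolution, an iterated counit. -/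
def comonadAugmentation (n : SimplexCategoryᵒᵖ) : (comonadResolution G X).obj n ⟶ X :=
  barMap G X 0 _ (monoEmpty _)

theorem comonadAugmentation_naturality {n k : SimplexCategoryᵒᵖ} (f : n ⟶ k) :
    (comonadResolution G X).map f ≫ comonadAugmentation G X k = comonadAugmentation G X n := by
  refine (barMap_comp G X _ _ _ _ _).trans ?_
  congr 1
  ext i
  exact i.elim0

end Bar

/-! ### Simplicial mapping spaces -/

section MapSpace

variable (𝒳 : SimplicialObject Cat.{0, 0})

/-- The iterated degeneracy in dimension `n` of an object `a` of the category `𝒳 _0`. -/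
def degObj (a : 𝒳.obj (op (SimplexCategory.mk 0))) (n : SimplexCategoryᵒᵖ) : 𝒳.obj n :=
  (𝒳.map (SimplexCategory.const n.unop (SimplexCategory.mk 0) 0).op).toFunctor.obj a

theorem map_degObj (a : 𝒳.obj (op (SimplexCategory.mk 0))) {n k : SimplexCategoryᵒᵖ}
    (f : n ⟶ k) : (𝒳.map f).toFunctor.obj (degObj 𝒳 a n) = degObj 𝒳 a k := by
  have h : (SimplexCategory.const n.unop (SimplexCategory.mk 0) 0).op ≫ f =
      (SimplexCategory.const k.unop (SimplexCategory.mk 0) 0).op :=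
    Quiver.Hom.unop_inj (Subsingleton.elim _ _)
  unfold degObj
  rw [← h, Functor.map_comp]
  rfl

/-- The simplicial mapping space between two objects of a simplicial object in `Cat`, of which the
simplicial set of objects is regarded as constant: the `n`-simplices are the morphisms `a ⟶ b` of
the `n`-th category, where `a`, `b` are viewed as objects of it through the degeneracies.
A morphism is recorded as an arrow with prescribed source and target. -/
def mapSpace (a b : 𝒳.obj (op (SimplexCategory.mk 0))) : SSet.{0} where
  obj n := {φ : Arrow (𝒳.obj n) // φ.left = degObj 𝒳 a n ∧ φ.right = degObj 𝒳 b n}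
  map f := ↾fun φ => ⟨(𝒳.map f).toFunctor.mapArrow.obj φ.1,
    (congrArg (𝒳.map f).toFunctor.obj φ.2.1).trans (map_degObj 𝒳 a f),
    (congrArg (𝒳.map f).toFunctor.obj φ.2.2).trans (map_degObj 𝒳 b f)⟩
  map_id n := by
    ext φ
    change (𝒳.map (𝟙 n)).toFunctor.mapArrow.obj φ.1 = φ.1
    rw [CategoryTheory.Functor.map_id]
    rfl
  map_comp f g := by
    ext φ
    change (𝒳.map (f ≫ g)).toFunctor.mapArrow.obj φ.1 = _
    rw [Functor.map_comp]
    rfl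

end MapSpace

/-! ### The free resolution of a small category -/

section DK

/-- The comonad `F U` on small categories: `U` is the forgetful functor to reflexive directed
graphs and `F` the free category functor, so that `F U C` is the free category generated by the
non-identity morphisms of `C`. -/
def freeComonad : Comonad Cat.{0, 0} := ReflQuiv.adj.{0, 0}.toComonad

/-- The free (Dwyer-Kan) resolution: `DK C _n = (F U) ^ (n + 1) C`. -/
def DK (C : Cat.{0, 0}) : SimplicialObject Cat.{0, 0} := comonadResolution freeComonad C

variable {C : Type} [SmallCategory C]

/-- The object of `DK C _0 = F U C` given by an object of `C`. -/
def DK.of (x : C) : (DK (Cat.of C)).obj (op (SimplexCategory.mk 0)) := Cat.FreeRefl.mk x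

/-- The simplicial mapping space `DK C (x, y)`. -/
def DKMap (x y : C) : SSet.{0} := mapSpace (DK (Cat.of C)) (DK.of x) (DK.of y)

/-- The simplices of `DK C (x, y)` lying over `θ : x ⟶ y`, that is, those mapped to `θ` by the
augmentation `DK C ⟶ C`, which composes all the letters. -/
def DKComponent {x y : C} (θ : x ⟶ y) : (DKMap x y).Subcomplex where
  obj n := {φ | (comonadAugmentation freeComonad (Cat.of C) n).toFunctor.mapArrow.obj φ.1 =
    Arrow.mk θ}
  map {n k} f φ hφ := by
    have h := comonadAugmentation_naturality freeComonad (Cat.of C) f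
    have h' : ((DK (Cat.of C)).map f ≫
        comonadAugmentation freeComonad (Cat.of C) k).toFunctor.mapArrow.obj φ.1 = Arrow.mk θ := by
      erw [h]
      exact hφ
    exact h'

/-- A morphism that is not an identity. -/
def IsNonIdentity {a b : C} (e : a ⟶ b) : Prop := ¬ ∃ h : a = b, e = eqToHom h

/-- All the letters of a path of morphisms are non-identity morphisms. -/
def PathReduced {x : C} : {y : C} → Quiver.Path x y → Prop
  | _, .nil => True
  | _, .cons p e => PathReduced p ∧ IsNonIdentity e

/-- The factorizations `θ = θ_k ∘ ... ∘ θ_1` of a morphism into any number `k ≥ 0` of non-identity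
morphisms, as paths of morphisms (the path has length `k`, and its composite is `θ`). -/
def Factorization {x y : C} (θ : x ⟶ y) : Type :=
  {p : Quiver.Path x y // composePath p = θ ∧ PathReduced p}

/-- The morphism of `F U C` represented by a path of morphisms of `C`. -/
def pathToFree {x y : C} (p : Quiver.Path x y) : Arrow (Cat.FreeRefl C) :=
  Arrow.mk ((Cat.FreeRefl.quotientFunctor C).map p)

end DK

/-- For a path `x = x_0 ⟶ x_1 ⟶ ... ⟶ x_k` in the opposite of the restricted simplex category, each
partial composite `x ⟶ x_i` is an injection from `x_i` to `x`.  This is the number of indices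
`i` in `{1, ..., k}` for which the element `a` of `x` does not lie in the image of `x_i`. -/
def missCount {x : PlusDeltaᵒᵖ} : {y : PlusDeltaᵒᵖ} → Quiver.Path x y → Fin x.unop.card → ℕ
  | _, .nil, _ => 0
  | _, .cons p e, a =>
    open Classical in
    missCount p a +
      if a ∈ Set.range (PlusDelta.emb (composePath (p.cons e)).unop) then 0 else 1

/-! ### Ordered partitions and permutahedra -/

/-- An ordered partition of `{0, ..., n - 1}` into `blocks` nonempty blocks, given by the
surjective map that sends an element to the position of its block. -/
structure OrderedPartition (n : ℕ) : Type where
  /-- the number of blocks -/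
  blocks : ℕ
  /-- the position of the block of an element -/
  block : Fin n → Fin blocks
  surjective : Function.Surjective block

section Permutahedron

variable {n : ℕ} (x : Fin n → ℝ)

/-- The permutahedron: the convex hull of the points obtained by permuting the coordinates
of `x`. For `n` distinct reals `x 0, ..., x (n - 1)` it is called the `(n - 1)`-permutahedron. -/
def permutahedron : Set (Fin n → ℝ) :=
  convexHull ℝ (Set.range fun σ : Equiv.Perm (Fin n) => x ∘ σ)

/-- The permutations `σ` for which the coordinates of `x ∘ σ` at the elements of an earlier block
are smaller than those at the elements of a later block. -/
noncomputable def OrderedPartition.perms (P : OrderedPartition n) : Finset (Equiv.Perm (Fin n)) :=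
  open Classical in
  Finset.univ.filter fun σ => ∀ a b, P.block a < P.block b → x (σ a) < x (σ b)

/-- The face of the permutahedron that belongs to an ordered partition: the convex hull of the
vertices whose coordinates increase from each block to the next. -/
def OrderedPartition.face (P : OrderedPartition n) : Set (Fin n → ℝ) :=
  convexHull ℝ ((fun σ : Equiv.Perm (Fin n) => x ∘ σ) '' (P.perms x : Set (Equiv.Perm (Fin n))))

/-- The barycentre of the face: the mean of its vertices. -/
noncomputable def OrderedPartition.barycenter (P : OrderedPartition n) : Fin n → ℝ :=
  ((P.perms x).card : ℝ)⁻¹ • ∑ σ ∈ P.perms x, x ∘ σ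

end Permutahedron

/-! ### Triangulations -/

section Triangulation

/-- The point of the geometric realization `|K|` with barycentric coordinates `t` in the
simplex `s`. -/
noncomputable def simplexPoint {K : SSet.{0}} {n : ℕ}
    (s : K.obj (op (SimplexCategory.mk n))) (t : stdSimplex ℝ (Fin (n + 1))) : SSet.toTop.obj K :=
  SSet.toTop.map (SSet.yonedaEquiv.symm s) ((SimplexCategory.mk n).toTopHomeo.symm t)

/-- The `i`-th vertex of a simplex. -/
def simplexVertex {K : SSet.{0}} {n : ℕ} (s : K.obj (op (SimplexCategory.mk n)))
    (i : Fin (n + 1)) : K.obj (op (SimplexCategory.mk 0)) :=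
  K.map (SimplexCategory.const (SimplexCategory.mk 0) (SimplexCategory.mk n) i).op s

/-- The point of `|K|` given by a `0`-simplex. -/
noncomputable def vertexPoint {K : SSet.{0}} (v : K.obj (op (SimplexCategory.mk 0))) :
    SSet.toTop.obj K :=
  simplexPoint (n := 0) v (stdSimplex.vertex 0)

/-- A homeomorphism from the realization of a simplicial set `K` onto a subset `P` of `ℝ ^ d` is a
triangulation of `P` by `K` if every simplex is mapped to `P` by the restriction of an affine map,
and every nondegenerate simplex injectively: then the nondegenerate simplices of `K` are mapped
to honest affine simplices, which cover `P`, have disjoint relative interiors, and have their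
faces among them. -/
structure IsTriangulation {K : SSet.{0}} {d : ℕ} {P : Set (Fin d → ℝ)}
    (h : SSet.toTop.obj K ≃ₜ P) : Prop where
  affine : ∀ (n : ℕ) (s : K.obj (op (SimplexCategory.mk n))),
    ∃ g : (Fin (n + 1) → ℝ) →ᵃ[ℝ] (Fin d → ℝ),
      ∀ t : stdSimplex ℝ (Fin (n + 1)), (h (simplexPoint s t) : Fin d → ℝ) = g t
  injective : ∀ (n : ℕ), ∀ s ∈ K.nonDegenerate n,
    Function.Injective fun t : stdSimplex ℝ (Fin (n + 1)) => h (simplexPoint s t)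

end Triangulation

/-! Two independent facts are joined. `C_θ` is the order complex of the poset of ordered partitions
of the complement of the image of `θ`, ordered by refinement (`isOrderComplex_DKComponent`). For
distinct reals `x`, the realization of that order complex is the barycentric subdivision of the
permutahedron (`IsOrderComplex.exists_homeomorph_permutahedron`).

Geometry. Let `M(U)` be the maximum of `∑ a ∈ U, y a` over the permutahedron; the slack of `U` at
`y` is `M(U) - ∑ a ∈ U, y a`. By the equality case of the rearrangement inequality, a functional is
maximal exactly at the vertices ordered like its coefficients. Hence the exposed faces are indexed
by ordered partitions `P`, and at the barycentre `b_P` the tight sets are exactly the final segments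
of `P` (`slack_barycenter_eq_zero_iff`). Strict submodularity of `M` makes the tight sets at any
point a chain (`tight_subset_or_subset`), which is the chain of final segments of some `P`. Starting
at this `b_P` and moving through `y` until a new set becomes tight writes `y`, by induction, as a
convex combination of barycentres of a flag (`exists_flag_weights`). Such a combination is unique,
since the zero set of its slacks reveals the least member of the flag (`weights_unique`). A
continuous bijection from a compact space to a Hausdorff space is then the homeomorphism.

Combinatorics. A simplex of dimension `n` is an `(n+1)`-fold nested word. Keeping one level of
brackets and composing the others gives its vertices, each a subdivision of the preceding one. In
`PlusDeltaᵒᵖ` every non-identity morphism lowers the cardinality. Hence a reduced word visits no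
object twice, and an intermediate object determines where a word is cut. Therefore a nested word is
determined by its vertices (`IsGrading.iterFree_hom_ext`), and every chain of subdivisions occurs
(`IsGrading.exists_iterVertex`).

Finally, a factorization of `θ` is a strictly decreasing chain of subsets from the whole source to
the image of `θ`. It is encoded by the level function `missCount`, whose sublevel sets are the
members of the chain. The nonzero levels are the blocks of an ordered partition, and subdivision of
words is refinement of levels (`isSubdivision_iff`). -/

/-! ### Refinement of ordered partitions -/

namespace OrderedPartition

variable {n : ℕ}

/-- The pairs of elements of which the first lies in an earlier block. -/
def precedes (P : OrderedPartition n) : Set (Fin n × Fin n) :=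
  {p | P.block p.1 < P.block p.2}

/-- Equal relations give strictly increasing maps between the block indices in both directions, so
the numbers of blocks agree; the only order automorphism of `Fin k` is the identity. -/
theorem precedes_injective : Function.Injective (precedes (n := n)) := by
  have key : ∀ P Q : OrderedPartition n, P.precedes = Q.precedes →
      ∃ φ : Fin P.blocks → Fin Q.blocks, StrictMono φ ∧ ∀ a, φ (P.block a) = Q.block a := by
    intro P Q h
    have hlt : ∀ a b, P.block a < P.block b ↔ Q.block a < Q.block b := fun a b =>
      Set.ext_iff.mp h (a, b)
    refine ⟨fun i => Q.block (Function.surjInv P.surjective i), fun i j hij => ?_, fun a => ?_⟩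
    · rw [← hlt, Function.surjInv_eq P.surjective, Function.surjInv_eq P.surjective]
      exact hij
    · have h1 : P.block (Function.surjInv P.surjective (P.block a)) = P.block a :=
        Function.surjInv_eq _ _
      refine le_antisymm (not_lt.mp fun h2 => ?_) (not_lt.mp fun h2 => ?_)
      · exact absurd ((hlt _ _).mpr h2) (by rw [h1]; exact lt_irrefl _)
      · exact absurd ((hlt _ _).mpr h2) (by rw [h1]; exact lt_irrefl _)
  intro P Q h
  obtain ⟨φ, hφ, hPQ⟩ := key P Q h
  obtain ⟨ψ, hψ, -⟩ := key Q P h.symm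
  have hcard : P.blocks = Q.blocks :=
    le_antisymm (by simpa using Fintype.card_le_of_injective φ hφ.injective)
      (by simpa using Fintype.card_le_of_injective ψ hψ.injective)
  obtain ⟨p, f, hf⟩ := P
  obtain ⟨q, g, hg⟩ := Q
  dsimp only at hcard φ ψ hPQ
  subst hcard
  have hid : ∀ i, φ i = i := by
    have h1 : Function.Surjective φ := Finite.surjective_of_injective hφ.injective
    have h2 := Subsingleton.elim (StrictMono.orderIsoOfSurjective φ hφ h1) (OrderIso.refl _)
    intro i
    exact DFunLike.congr_fun h2 i
  have : f = g := funext fun a => (hid _).symm.trans (hPQ a)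
  subst this
  rfl

/-- `P ≤ Q` if `Q` refines `P`. -/
instance : PartialOrder (OrderedPartition n) := PartialOrder.lift precedes precedes_injective

theorem le_iff {P Q : OrderedPartition n} :
    P ≤ Q ↔ ∀ a b, P.block a < P.block b → Q.block a < Q.block b :=
  ⟨fun h a b hab => @h (a, b) hab, fun h p hp => h p.1 p.2 hp⟩

instance : Finite (OrderedPartition n) := Finite.of_injective _ precedes_injective

noncomputable instance : Fintype (OrderedPartition n) := Fintype.ofFinite _

/-- The sets that consist of the elements of some final segment of the blocks. -/
def IsUpper (P : OrderedPartition n) (U : Finset (Fin n)) : Prop :=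
  ∀ a b, a ∉ U → b ∈ U → P.block a < P.block b

/-- The elements in blocks after that of `a` form a final segment that separates `a` from every
later `b`. Thus refinement can be tested on tight sets. -/
theorem le_of_isUpper {P Q : OrderedPartition n} (h : ∀ U, P.IsUpper U → Q.IsUpper U) :
    P ≤ Q := by
  refine le_iff.mpr fun a b hab => ?_
  refine h (Finset.univ.filter fun c => P.block a < P.block c) (fun c d hc hd => ?_) a b
    (by simp) (by simpa using hab)
  simp only [Finset.mem_filter, Finset.mem_univ, true_and, not_lt] at hc hd
  exact lt_of_le_of_lt hc hd

theorem IsUpper.mono {P Q : OrderedPartition n} (h : P ≤ Q) {U : Finset (Fin n)}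
    (hU : P.IsUpper U) : Q.IsUpper U := fun a b ha hb => le_iff.mp h a b (hU a b ha hb)

/-- The ordered partition into the level sets of a function. -/
theorem exists_of_levels {α : Type*} [LinearOrder α] (c : Fin n → α) :
    ∃ P : OrderedPartition n, ∀ a b, P.block a < P.block b ↔ c a < c b := by
  classical
  let s := Finset.univ.image c
  let e : Fin s.card ≃o s := s.orderIsoOfFin rfl
  refine ⟨⟨s.card, fun a => e.symm ⟨c a, Finset.mem_image_of_mem c (Finset.mem_univ a)⟩, ?_⟩, ?_⟩
  · intro i
    obtain ⟨a, -, ha⟩ := Finset.mem_image.mp (e i).2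
    refine ⟨a, ?_⟩
    rw [OrderIso.symm_apply_eq]
    exact Subtype.ext ha
  · intro a b
    dsimp only
    rw [OrderIso.lt_iff_lt]
    rfl

end OrderedPartition

/-! ### Supporting functionals of the permutahedron -/

section Adapted

variable {n : ℕ} {x : Fin n → ℝ}

theorem monovary_comp_iff (hx : Function.Injective x) (c : Fin n → ℝ) (σ : Equiv.Perm (Fin n)) :
    Monovary c (x ∘ σ) ↔ ∀ a b, c a < c b → x (σ a) < x (σ b) := by
  refine ⟨fun h a b hab => lt_of_not_ge fun hle => ?_, fun h a b hab => not_lt.mp fun hlt => ?_⟩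
  · rcases hle.lt_or_eq with h1 | h1
    · exact absurd (h h1) (not_le.mpr hab)
    · have := σ.injective (hx h1)
      subst this
      exact lt_irrefl _ hab
  · exact absurd hab (not_lt.mpr (h _ _ hlt).le)

theorem exists_perm_monovary (x c : Fin n → ℝ) : ∃ σ : Equiv.Perm (Fin n), Monovary c (x ∘ σ) := by
  refine ⟨(Tuple.sort c)⁻¹.trans (Tuple.sort x), ?_⟩
  have h : Monovary (c ∘ Tuple.sort c) (x ∘ Tuple.sort x) :=
    (Tuple.monotone_sort c).monovary (Tuple.monotone_sort x)
  intro a b hab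
  have := @h ((Tuple.sort c)⁻¹ a) ((Tuple.sort c)⁻¹ b) hab
  simpa using this

theorem sum_mul_perm_le {c : Fin n → ℝ} {σ : Equiv.Perm (Fin n)} (h : Monovary c (x ∘ σ))
    (τ : Equiv.Perm (Fin n)) : ∑ a, c a * x (τ a) ≤ ∑ a, c a * x (σ a) := by
  have := h.sum_mul_comp_perm_le_sum_mul (σ := τ.trans σ⁻¹)
  simpa using this

/-- Equality case of the rearrangement inequality. The whole description of the faces rests on it.
-/
theorem sum_mul_perm_eq_iff {c : Fin n → ℝ} {σ : Equiv.Perm (Fin n)} (h : Monovary c (x ∘ σ))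
    (τ : Equiv.Perm (Fin n)) :
    ∑ a, c a * x (τ a) = ∑ a, c a * x (σ a) ↔ Monovary c (x ∘ τ) := by
  have := h.sum_mul_comp_perm_eq_sum_mul_iff (σ := τ.trans σ⁻¹)
  have h2 : (x ∘ σ) ∘ (τ.trans σ⁻¹) = x ∘ τ := by ext; simp
  rw [h2] at this
  simpa using this

theorem comp_mem_permutahedron (x : Fin n → ℝ) (σ : Equiv.Perm (Fin n)) :
    x ∘ σ ∈ permutahedron x := subset_convexHull ℝ _ ⟨σ, rfl⟩

theorem OrderedPartition.mem_perms {P : OrderedPartition n} {σ : Equiv.Perm (Fin n)} :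
    σ ∈ P.perms x ↔ ∀ a b, P.block a < P.block b → x (σ a) < x (σ b) := by
  simp [OrderedPartition.perms]

theorem OrderedPartition.mem_perms_iff_monovary (hx : Function.Injective x)
    {P : OrderedPartition n} {σ : Equiv.Perm (Fin n)} :
    σ ∈ P.perms x ↔ Monovary (fun a => ((P.block a : ℕ) : ℝ)) (x ∘ σ) := by
  rw [monovary_comp_iff hx, OrderedPartition.mem_perms]
  simp

theorem OrderedPartition.perms_nonempty (hx : Function.Injective x) (P : OrderedPartition n) :
    (P.perms x).Nonempty := by
  obtain ⟨σ, hσ⟩ := exists_perm_monovary x (fun a => ((P.block a : ℕ) : ℝ))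
  exact ⟨σ, (OrderedPartition.mem_perms_iff_monovary hx).mpr hσ⟩

/-- Two elements of the same block can be exchanged. -/
theorem OrderedPartition.swap_mem_perms {P : OrderedPartition n} {σ : Equiv.Perm (Fin n)}
    (hσ : σ ∈ P.perms x) {a b : Fin n} (hab : P.block a = P.block b) :
    (Equiv.swap a b).trans σ ∈ P.perms x := by
  have h1 : ∀ c, P.block (Equiv.swap a b c) = P.block c := by
    intro c
    rw [Equiv.swap_apply_def]
    split_ifs with h h
    · rw [h, hab]
    · rw [h, hab]
    · rfl
  rw [OrderedPartition.mem_perms] at hσ ⊢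
  intro c d hcd
  exact hσ _ _ (by rwa [h1, h1])

end Adapted

/-! ### Facet inequalities of the permutahedron and flags of barycentres -/

section Slack

variable {n : ℕ} (x : Fin n → ℝ)

theorem exists_maximal_perm (U : Finset (Fin n)) :
    ∃ σ : Equiv.Perm (Fin n), ∀ τ : Equiv.Perm (Fin n),
      ∑ a ∈ U, x (τ a) ≤ ∑ a ∈ U, x (σ a) := by
  obtain ⟨σ, -, hσ⟩ := Finset.exists_max_image (Finset.univ : Finset (Equiv.Perm (Fin n)))
    (fun σ => ∑ a ∈ U, x (σ a)) ⟨1, Finset.mem_univ _⟩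
  exact ⟨σ, fun τ => hσ τ (Finset.mem_univ _)⟩

/-- The maximum of `∑ a ∈ U, y a` over the permutahedron. -/
noncomputable def permMax (U : Finset (Fin n)) : ℝ :=
  ∑ a ∈ U, x ((exists_maximal_perm x U).choose a)

/-- The slack of the facet inequality of the permutahedron for the set `U` at the point `y`. -/
noncomputable def slack (y : Fin n → ℝ) (U : Finset (Fin n)) : ℝ := permMax x U - ∑ a ∈ U, y a

variable {x}

theorem slack_perm_nonneg (σ : Equiv.Perm (Fin n)) (U : Finset (Fin n)) :
    0 ≤ slack x (x ∘ σ) U :=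
  sub_nonneg.mpr ((exists_maximal_perm x U).choose_spec σ)

/-- Rearrangement for the indicator function of `U`: the sum over `U` is maximal exactly when the
largest values sit on `U`. -/
theorem slack_perm_eq_zero_iff (hx : Function.Injective x) (σ : Equiv.Perm (Fin n))
    (U : Finset (Fin n)) :
    slack x (x ∘ σ) U = 0 ↔ ∀ a b, a ∉ U → b ∈ U → x (σ a) < x (σ b) := by
  classical
  let c : Fin n → ℝ := fun a => if a ∈ U then 1 else 0
  have hc : ∀ τ : Equiv.Perm (Fin n), ∑ a, c a * x (τ a) = ∑ a ∈ U, x (τ a) := by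
    intro τ
    simp [c]
  obtain ⟨ρ, hρ⟩ := exists_perm_monovary x c
  have hmax : permMax x U = ∑ a ∈ U, x (ρ a) := by
    refine le_antisymm ?_ ((exists_maximal_perm x U).choose_spec ρ)
    have := sum_mul_perm_le hρ (exists_maximal_perm x U).choose
    rwa [hc, hc] at this
  have h1 := sum_mul_perm_eq_iff hρ σ
  rw [hc, hc, monovary_comp_iff hx] at h1
  have h2 : slack x (x ∘ σ) U = 0 ↔ ∑ a ∈ U, x (σ a) = ∑ a ∈ U, x (ρ a) := by
    rw [slack, hmax, sub_eq_zero, eq_comm]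
    rfl
  rw [h2, h1]
  refine forall₂_congr fun a b => ?_
  by_cases ha : a ∈ U <;> by_cases hb : b ∈ U <;> simp [c, ha, hb]

/-- The slack of a fixed `U` is an affine function of the point. The weights may have any sign. -/
theorem slack_sum {ι : Type*} (s : Finset ι) (w : ι → ℝ) (hw : ∑ i ∈ s, w i = 1)
    (p : ι → Fin n → ℝ) (U : Finset (Fin n)) :
    slack x (∑ i ∈ s, w i • p i) U = ∑ i ∈ s, w i * slack x (p i) U := by
  simp only [slack, mul_sub, Finset.sum_sub_distrib, ← Finset.sum_mul, hw, one_mul,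
    Finset.sum_apply, Pi.smul_apply, smul_eq_mul, Finset.mul_sum]
  rw [Finset.sum_comm]

theorem slack_nonneg_of_mem {y : Fin n → ℝ} (hy : y ∈ permutahedron x) (U : Finset (Fin n)) :
    0 ≤ slack x y U := by
  have : permutahedron x ⊆ {y | 0 ≤ slack x y U} := by
    refine convexHull_min ?_ ?_
    · rintro _ ⟨σ, rfl⟩
      exact slack_perm_nonneg σ U
    · intro y hy z hz a b ha hb hab
      have := slack_sum (x := x) Finset.univ ![a, b] (by simpa using hab) ![y, z] U
      simp only [Fin.sum_univ_two, Matrix.cons_val_zero, Matrix.cons_val_one] at this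
      simp only [Set.mem_ofPred_eq] at hy hz ⊢
      rw [this]
      positivity
  exact this hy

theorem slack_univ_of_mem {y : Fin n → ℝ} (hy : y ∈ permutahedron x) :
    slack x y Finset.univ = 0 := by
  have : permutahedron x ⊆ {y | slack x y Finset.univ = 0} := by
    refine convexHull_min ?_ ?_
    · rintro _ ⟨σ, rfl⟩
      simp [slack, permMax, Equiv.sum_comp]
    · intro y hy z hz a b ha hb hab
      have := slack_sum (x := x) Finset.univ ![a, b] (by simpa using hab) ![y, z] Finset.univ
      simp only [Fin.sum_univ_two, Matrix.cons_val_zero, Matrix.cons_val_one] at this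
      simp only [Set.mem_ofPred_eq] at hy hz ⊢
      rw [this, hy, hz]
      simp
  exact this hy

theorem slack_empty (y : Fin n → ℝ) : slack x y ∅ = 0 := by simp [slack, permMax]

namespace OrderedPartition

theorem perms_card_pos (hx : Function.Injective x) (P : OrderedPartition n) :
    (0 : ℝ) < (P.perms x).card := by
  exact_mod_cast (P.perms_nonempty hx).card_pos

theorem barycenter_eq_sum (P : OrderedPartition n) :
    P.barycenter x = ∑ σ ∈ P.perms x, ((P.perms x).card : ℝ)⁻¹ • (x ∘ σ) := by
  rw [OrderedPartition.barycenter, Finset.smul_sum]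

theorem sum_weights (hx : Function.Injective x) (P : OrderedPartition n) :
    ∑ _σ ∈ P.perms x, ((P.perms x).card : ℝ)⁻¹ = 1 := by
  rw [Finset.sum_const, nsmul_eq_mul, mul_inv_cancel₀ (P.perms_card_pos hx).ne']

theorem barycenter_mem (hx : Function.Injective x) (P : OrderedPartition n) :
    P.barycenter x ∈ permutahedron x := by
  rw [barycenter_eq_sum]
  exact (convex_convexHull ℝ _).sum_mem (fun _ _ => inv_nonneg.mpr (P.perms_card_pos hx).le)
    (P.sum_weights hx) (fun σ _ => comp_mem_permutahedron x σ)

/-- A mean of nonnegative slacks vanishes only if each one does, so `U` must be tight at every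
vertex of the face. Exchanging two elements of one block then shows that `U` cannot separate them.
-/
theorem slack_barycenter_eq_zero_iff (hx : Function.Injective x) (P : OrderedPartition n)
    (U : Finset (Fin n)) : slack x (P.barycenter x) U = 0 ↔ P.IsUpper U := by
  have h1 : slack x (P.barycenter x) U = 0 ↔
      ∀ σ ∈ P.perms x, ∀ a b, a ∉ U → b ∈ U → x (σ a) < x (σ b) := by
    rw [barycenter_eq_sum, slack_sum _ _ (P.sum_weights hx), Finset.sum_eq_zero_iff_of_nonneg]
    · refine forall₂_congr fun σ _ => ?_
      rw [mul_eq_zero, slack_perm_eq_zero_iff hx]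
      simp [(P.perms_nonempty hx).ne_empty]
    · exact fun σ _ => mul_nonneg (inv_nonneg.mpr (P.perms_card_pos hx).le) (slack_perm_nonneg σ U)
  rw [h1]
  constructor
  · intro h a b ha hb
    obtain ⟨σ, hσ⟩ := P.perms_nonempty hx
    rcases lt_trichotomy (P.block a) (P.block b) with h2 | h2 | h2
    · exact h2
    · have h3 := h _ (swap_mem_perms hσ h2) a b ha hb
      simp only [Equiv.trans_apply, Equiv.swap_apply_left, Equiv.swap_apply_right] at h3
      exact absurd (h σ hσ a b ha hb) h3.not_gt
    · exact absurd (h σ hσ a b ha hb) (mem_perms.mp hσ _ _ h2).not_gt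
  · intro h σ hσ a b ha hb
    exact mem_perms.mp hσ _ _ (h a b ha hb)

end OrderedPartition

/-- Strict submodularity of the facet inequalities: the tight ones form a chain. -/
theorem tight_subset_or_subset (hx : Function.Injective x) {y : Fin n → ℝ}
    (hy : ∀ U, 0 ≤ slack x y U) {U V : Finset (Fin n)} (hU : slack x y U = 0)
    (hV : slack x y V = 0) : U ⊆ V ∨ V ⊆ U := by
  classical
  by_contra! h
  obtain ⟨a, haU, haV⟩ := Finset.not_subset.mp h.1
  obtain ⟨b, hbV, hbU⟩ := Finset.not_subset.mp h.2
  -- The weights are `2` on the intersection, `1` on the rest of the union and `0` elsewhere, so a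
  -- vertex sorted by `c` is tight for the intersection and the union at once.
  let c : Fin n → ℝ := fun a => (if a ∈ U ∩ V then 1 else 0) + if a ∈ U ∪ V then 1 else 0
  obtain ⟨σ, hσ⟩ := exists_perm_monovary x c
  rw [monovary_comp_iff hx] at hσ
  have hI : slack x (x ∘ σ) (U ∩ V) = 0 := by
    rw [slack_perm_eq_zero_iff hx]
    intro i j hi hj
    refine hσ i j ?_
    have hj' : j ∈ U ∪ V := Finset.mem_union_left _ (Finset.mem_inter.mp hj).1
    simp only [c, if_neg hi, if_pos hj, if_pos hj']
    split_ifs <;> norm_num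
  have hJ : slack x (x ∘ σ) (U ∪ V) = 0 := by
    rw [slack_perm_eq_zero_iff hx]
    intro i j hi hj
    refine hσ i j ?_
    have hi' : i ∉ U ∩ V := fun h => hi (Finset.mem_union_left _ (Finset.mem_inter.mp h).1)
    simp only [c, if_neg hi, if_pos hj, if_neg hi']
    split_ifs <;> norm_num
  -- Comparing this identity at `y` and at the sorted vertex forces that vertex to be tight for `U`
  -- and for `V`, which orders `a` and `b` in both ways.
  have modular : ∀ z : Fin n → ℝ, ∑ a ∈ U ∪ V, z a + ∑ a ∈ U ∩ V, z a =
      ∑ a ∈ U, z a + ∑ a ∈ V, z a := fun z => Finset.sum_union_inter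
  have h1 := modular y
  have h2 := modular (x ∘ σ)
  have h3 := hy (U ∩ V)
  have h4 := hy (U ∪ V)
  have h5 := slack_perm_nonneg (x := x) σ U
  have h6 := slack_perm_nonneg (x := x) σ V
  have h7 : slack x (x ∘ σ) U = 0 := by
    simp only [slack] at *
    linarith
  have h8 : slack x (x ∘ σ) V = 0 := by
    simp only [slack] at *
    linarith
  rw [slack_perm_eq_zero_iff hx] at h7 h8
  exact lt_asymm (h7 b a hbU haU) (h8 a b haV hbV)

/-- A chain of sets that contains `∅` and the whole set consists of the final segments of an
ordered partition. -/
theorem OrderedPartition.exists_isUpper_iff (T : Finset (Fin n) → Prop)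
    (hchain : ∀ U V, T U → T V → U ⊆ V ∨ V ⊆ U) (hempty : T ∅) (huniv : T Finset.univ) :
    ∃ P : OrderedPartition n, ∀ U, P.IsUpper U ↔ T U := by
  classical
  -- Elements are ranked by the number of members of the chain that contain them; more members means
  -- a later block.
  let c : Fin n → ℕ := fun a => (Finset.univ.filter fun U => T U ∧ a ∈ U).card
  have h1 : ∀ U, T U → ∀ a b, a ∉ U → b ∈ U → c a < c b := by
    intro U hU a b ha hb
    refine Finset.card_lt_card ((Finset.ssubset_iff_of_subset fun V hV => ?_).mpr
      ⟨U, by simp [hU, hb], by simp [ha]⟩)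
    simp only [Finset.mem_filter, Finset.mem_univ, true_and] at hV ⊢
    rcases hchain U V hU hV.1 with h | h
    · exact ⟨hV.1, h hb⟩
    · exact absurd (h hV.2) ha
  have h2 : ∀ a b, c a < c b → ∃ U, T U ∧ b ∈ U ∧ a ∉ U := by
    intro a b hab
    by_contra! h
    refine absurd hab (not_lt.mpr (Finset.card_le_card fun U hU => ?_))
    simp only [Finset.mem_filter, Finset.mem_univ, true_and] at hU ⊢
    exact ⟨hU.1, h U hU.1 hU.2⟩
  obtain ⟨P, hP⟩ := OrderedPartition.exists_of_levels c
  refine ⟨P, fun V => ⟨fun hV => ?_, fun hV a b ha hb => (hP a b).mpr (h1 V hV a b ha hb)⟩⟩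
  rcases V.eq_empty_or_nonempty with rfl | hne
  · exact hempty
  rcases (Finset.univ \ V).eq_empty_or_nonempty with hco | hco
  · rw [Finset.sdiff_eq_empty_iff_subset, Finset.univ_subset_iff] at hco
    exact hco ▸ huniv
  obtain ⟨b, hbV, hb⟩ := Finset.exists_min_image V c hne
  obtain ⟨a, haV, ha⟩ := Finset.exists_max_image (Finset.univ \ V) c hco
  simp only [Finset.mem_sdiff, Finset.mem_univ, true_and] at haV ha
  obtain ⟨U, hU, hbU, haU⟩ := h2 a b ((hP a b).mp (hV a b haV hbV))
  -- `a` is highest outside `V` and `b` is lowest inside it, so a member of the chain separating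
  -- these two can only be `V`.
  have : U = V := by
    ext d
    constructor
    · intro hd
      by_contra hdV
      exact absurd (h1 U hU a d haU hd) (not_lt.mpr (ha d hdV))
    · intro hd
      by_contra hdU
      exact absurd (h1 U hU d b hdU hbU) (not_lt.mpr (hb d hd))
  exact this ▸ hU

/-- A point at which no slack exceeds that of another point with the same total is this point. -/
theorem eq_of_slack_le {y z : Fin n → ℝ} (h : ∀ U, slack x z U ≤ slack x y U)
    (huniv : slack x z Finset.univ = slack x y Finset.univ) : y = z := by
  have h1 : ∀ a ∈ Finset.univ, y a ≤ z a := by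
    intro a _
    have := h {a}
    simp only [slack, Finset.sum_singleton] at this
    linarith
  have h2 : ∑ a, y a = ∑ a, z a := by
    simp only [slack] at huniv
    linarith
  exact funext fun a => (Finset.sum_eq_sum_iff_of_le h1).mp h2 a (Finset.mem_univ a)

/-- Every point with nonnegative slacks and the right total is a convex combination of the
barycentres of a flag of faces. -/
theorem exists_flag_weights (hx : Function.Injective x) (y : Fin n → ℝ)
    (hy : ∀ U, 0 ≤ slack x y U) (huniv : slack x y Finset.univ = 0) :
    ∃ w : OrderedPartition n → ℝ, (∀ P, 0 ≤ w P) ∧ ∑ P, w P = 1 ∧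
      (∀ P Q, w P ≠ 0 → w Q ≠ 0 → P ≤ Q ∨ Q ≤ P) ∧ ∑ P, w P • P.barycenter x = y := by
  classical
  -- Induction on the number of sets that are not tight at `y`; the partition `P` below has exactly
  -- the tight sets of `y` as final segments.
  induction hk : (Finset.univ.filter fun U => slack x y U ≠ 0).card using Nat.strong_induction_on
    generalizing y with
  | _ k ih =>
  subst hk
  obtain ⟨P, hP⟩ := OrderedPartition.exists_isUpper_iff (fun U => slack x y U = 0)
    (fun U V hU hV => tight_subset_or_subset hx hy hU hV) (slack_empty y) huniv
  set b := P.barycenter x with hb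
  have hb0 : ∀ U, slack x b U = 0 ↔ slack x y U = 0 := fun U => by
    rw [hb, P.slack_barycenter_eq_zero_iff hx, hP]
  have hbnn : ∀ U, 0 ≤ slack x b U := slack_nonneg_of_mem (P.barycenter_mem hx)
  by_cases hle : ∀ U, slack x b U ≤ slack x y U
  · have := eq_of_slack_le hle (by rw [huniv, hb0, huniv])
    refine ⟨Pi.single P 1, fun Q => ?_, by simp, fun Q R hQ hR => ?_, ?_⟩
    · by_cases h : Q = P
      · subst h; simp
      · simp [h]
    · have h1 : Q = P := by by_contra h; simp [h] at hQ
      have h2 : R = P := by by_contra h; simp [h] at hR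
      exact Or.inl (h1.trans h2.symm).le
    · rw [Finset.sum_eq_single P]
      · simp [this, hb]
      · intro Q _ hQ
        simp [hQ]
      · simp
  push Not at hle
  obtain ⟨U₁, hU₁⟩ := hle
  have hpos : ∀ U, slack x y U ≠ 0 → 0 < slack x b U := fun U hU =>
    lt_of_le_of_ne (hbnn U) (Ne.symm (mt (hb0 U).mp hU))
  have hne₁ : slack x y U₁ ≠ 0 := fun h => by
    rw [h, (hb0 _).mpr h] at hU₁
    exact lt_irrefl _ hU₁
  obtain ⟨U₀, hU₀, hmin⟩ := Finset.exists_min_image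
    (Finset.univ.filter fun U => slack x y U ≠ 0) (fun U => slack x y U / slack x b U)
    ⟨U₁, by simp [hne₁]⟩
  simp only [Finset.mem_filter, Finset.mem_univ, true_and] at hU₀ hmin
  -- The largest `t` for which `y - t • b` keeps nonnegative slacks relative to the scaled bounds.
  -- The rescaled remainder `y'` lies on the ray from `b` through `y`, keeps the tight sets of `y`,
  -- and gains `U₀`.
  set t := slack x y U₀ / slack x b U₀ with ht
  have ht0 : 0 ≤ t := div_nonneg (hy _) (hbnn _)
  have ht1 : t < 1 := lt_of_le_of_lt (hmin U₁ hne₁) (by rwa [div_lt_one (hpos _ hne₁)])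
  have ht1' : 0 < 1 - t := by linarith
  set y' : Fin n → ℝ := (1 - t)⁻¹ • (y - t • b) with hy'
  have hyy : y = (1 - t) • y' + t • b := by
    rw [hy', smul_smul, mul_inv_cancel₀ ht1'.ne', one_smul, sub_add_cancel]
  have hs : ∀ U, slack x y U = (1 - t) * slack x y' U + t * slack x b U := by
    intro U
    have := slack_sum (x := x) Finset.univ ![1 - t, t] (by simp) ![y', b] U
    simp only [Fin.sum_univ_two, Matrix.cons_val_zero, Matrix.cons_val_one] at this
    rw [← this, ← hyy]
  have hle : ∀ U, t * slack x b U ≤ slack x y U := by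
    intro U
    by_cases hU : slack x y U = 0
    · rw [hU, (hb0 U).mpr hU, mul_zero]
    · exact (le_div_iff₀ (hpos U hU)).mp (hmin U hU)
  have hs' : ∀ U, 0 ≤ slack x y' U := by
    intro U
    have h1 := hs U
    have h2 := hle U
    exact nonneg_of_mul_nonneg_right (by linarith : 0 ≤ (1 - t) * slack x y' U) ht1'
  have hz : ∀ U, slack x y U = 0 → slack x y' U = 0 := by
    intro U hU
    have h1 := hs U
    rw [hU, (hb0 U).mpr hU, mul_zero, add_zero] at h1
    exact (mul_eq_zero.mp h1.symm).resolve_left ht1'.ne'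
  have hz₀ : slack x y' U₀ = 0 := by
    have h1 := hs U₀
    rw [ht, div_mul_cancel₀ _ (hpos U₀ hU₀).ne', ← ht] at h1
    exact (mul_eq_zero.mp (by linarith : (1 - t) * slack x y' U₀ = 0)).resolve_left ht1'.ne'
  obtain ⟨w, hw0, hw1, hwc, hwy⟩ := ih _ (Finset.card_lt_card
    ((Finset.ssubset_iff_of_subset fun U hU => by
        simp only [Finset.mem_filter, Finset.mem_univ, true_and] at hU ⊢
        exact mt (hz U) hU).mpr ⟨U₀, by simpa using hU₀, by simp [hz₀]⟩)) y' hs' (hz _ huniv) rfl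
  -- Sets tight at `y'` are tight at each barycentre of positive weight, so all of these refine `P`
  -- and `P` can be prepended to the flag.
  have hPw : ∀ Q, w Q ≠ 0 → P ≤ Q := by
    intro Q hQ
    refine OrderedPartition.le_of_isUpper fun U hU => ?_
    have h1 := hz U ((hP U).mp hU)
    rw [← hwy, slack_sum _ _ hw1, Finset.sum_eq_zero_iff_of_nonneg (fun R _ =>
      mul_nonneg (hw0 R) (slack_nonneg_of_mem (R.barycenter_mem hx) U))] at h1
    exact (Q.slack_barycenter_eq_zero_iff hx U).mp
      ((mul_eq_zero.mp (h1 Q (Finset.mem_univ Q))).resolve_left hQ)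
  refine ⟨fun Q => (1 - t) * w Q + t * (Pi.single P 1 : OrderedPartition n → ℝ) Q,
    fun Q => ?_, ?_, fun Q R hQ hR => ?_, ?_⟩
  · refine add_nonneg (mul_nonneg ht1'.le (hw0 Q)) (mul_nonneg ht0 ?_)
    by_cases h : Q = P
    · subst h; simp
    · simp [h]
  · rw [Finset.sum_add_distrib, ← Finset.mul_sum, ← Finset.mul_sum, hw1]
    simp
  · by_cases h1 : Q = P
    · subst h1
      by_cases h2 : R = Q
      · exact Or.inl h2.ge
      · exact Or.inl (hPw R fun h => hR (by simp [h, h2]))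
    · have h1' : w Q ≠ 0 := fun h => hQ (by simp [h, h1])
      by_cases h2 : R = P
      · subst h2
        exact Or.inr (hPw Q h1')
      · exact hwc Q R h1' fun h => hR (by simp [h, h2])
  · simp only [add_smul, Finset.sum_add_distrib, mul_smul, ← Finset.smul_sum, hwy]
    rw [hyy, Finset.sum_eq_single P]
    · simp [hb]
    · intro Q _ hQ
      simp [hQ]
    · simp

end Slack

/-- A combination with positive coefficients of a chain of nonnegative functions with different
zero sets determines the coefficients. -/
theorem weights_unique {ι X : Type*} [Fintype ι] [PartialOrder ι] (S : ι → X → ℝ)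
    (hS : ∀ i u, 0 ≤ S i u) (hle : ∀ i j, (∀ u, S i u = 0 → S j u = 0) ↔ i ≤ j)
    (t w : ι → ℝ) (ht : ∀ i, 0 ≤ t i) (hw : ∀ i, 0 ≤ w i)
    (htc : ∀ i j, t i ≠ 0 → t j ≠ 0 → i ≤ j ∨ j ≤ i)
    (hwc : ∀ i j, w i ≠ 0 → w j ≠ 0 → i ≤ j ∨ j ≤ i)
    (hsum : ∑ i, t i = ∑ i, w i) (h : ∀ u, ∑ i, t i * S i u = ∑ i, w i * S i u) : t = w := by
  classical
  induction hk : (Finset.univ.filter fun i => t i ≠ 0).card +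
    (Finset.univ.filter fun i => w i ≠ 0).card using Nat.strong_induction_on
    generalizing t w with
  | _ k ih =>
  have hzero : ∀ t : ι → ℝ, (∀ i, 0 ≤ t i) → ∑ i, t i = 0 → t = 0 := by
    intro t ht h0
    rw [Finset.sum_eq_zero_iff_of_nonneg fun i _ => ht i] at h0
    exact funext fun i => h0 i (Finset.mem_univ i)
  by_cases ht0 : t = 0
  · rw [ht0] at hsum
    rw [ht0, hzero w hw (by simpa using hsum.symm)]
  by_cases hw0 : w = 0
  · rw [hw0] at hsum
    rw [hw0, hzero t ht (by simpa using hsum)]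
  -- The least member of the support has the smallest zero set, which is therefore the zero set of
  -- the whole sum. Hence both combinations have the same least member.
  have least : ∀ t : ι → ℝ, (∀ i, 0 ≤ t i) → (∀ i j, t i ≠ 0 → t j ≠ 0 → i ≤ j ∨ j ≤ i) →
      t ≠ 0 → ∃ i, t i ≠ 0 ∧ ∀ u, ∑ i, t i * S i u = 0 ↔ S i u = 0 := by
    intro t ht htc ht0
    have hne : (Finset.univ.filter fun i => t i ≠ 0).Nonempty := by
      obtain ⟨i, hi⟩ := Function.ne_iff.mp ht0
      exact ⟨i, by simpa using hi⟩
    obtain ⟨i, hi⟩ := Finset.exists_minimal hne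
    have hti : t i ≠ 0 := by simpa using hi.1
    refine ⟨i, hti, fun u => ?_⟩
    rw [Finset.sum_eq_zero_iff_of_nonneg fun j _ => mul_nonneg (ht j) (hS j u)]
    refine ⟨fun h => (mul_eq_zero.mp (h i (Finset.mem_univ i))).resolve_left hti,
      fun h j _ => ?_⟩
    by_cases htj : t j = 0
    · rw [htj, zero_mul]
    · have hij : i ≤ j := (htc i j hti htj).elim id fun hji => hi.2 (by simpa using htj) hji
      rw [(hle i j).mpr hij u h, mul_zero]
  obtain ⟨i, hti, hi⟩ := least t ht htc ht0
  obtain ⟨j, hwj, hj⟩ := least w hw hwc hw0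
  have hij : i = j := le_antisymm
    ((hle i j).mp fun u hu => (hj u).mp ((h u).symm.trans ((hi u).mpr hu)))
    ((hle j i).mp fun u hu => (hi u).mp ((h u).trans ((hj u).mpr hu)))
  subst hij
  -- Subtracting the smaller of the two coefficients removes `i` from at least one support.
  set m := min (t i) (w i) with hm
  let d : ι → ℝ := Pi.single i m
  have hd : ∀ k, k ≠ i → d k = 0 := fun k hk => by simp [d, hk]
  have hdi : d i = m := by simp [d]
  have hmpos : 0 < m := lt_min (lt_of_le_of_ne (ht i) hti.symm) (lt_of_le_of_ne (hw i) hwj.symm)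
  have hsupp : ∀ t : ι → ℝ, t i ≠ 0 → ∀ k, (t - d) k ≠ 0 → t k ≠ 0 := by
    intro t hti k hk
    by_cases h : k = i
    · exact h ▸ hti
    · simpa [hd k h] using hk
  have hnn : ∀ t : ι → ℝ, (∀ i, 0 ≤ t i) → m ≤ t i → ∀ k, 0 ≤ (t - d) k := by
    intro t ht hmt k
    by_cases h : k = i
    · subst h
      simpa [hdi] using hmt
    · simpa [hd k h] using ht k
  have hcard : ∀ t : ι → ℝ, t i ≠ 0 → (Finset.univ.filter fun i => (t - d) i ≠ 0).card ≤
      (Finset.univ.filter fun i => t i ≠ 0).card := fun t hti =>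
    Finset.card_le_card fun k hk => by
      simp only [Finset.mem_filter, Finset.mem_univ, true_and] at hk ⊢
      exact hsupp t hti k hk
  have hcard' : ∀ t : ι → ℝ, t i ≠ 0 → t i = m →
      (Finset.univ.filter fun i => (t - d) i ≠ 0).card <
      (Finset.univ.filter fun i => t i ≠ 0).card := fun t hti hm =>
    Finset.card_lt_card ((Finset.ssubset_iff_of_subset fun k hk => by
      simp only [Finset.mem_filter, Finset.mem_univ, true_and] at hk ⊢
      exact hsupp t hti k hk).mpr ⟨i, by simpa using hti, by simp [hdi, hm]⟩)
  have key := ih _ (by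
    subst hk
    rcases min_choice (t i) (w i) with h1 | h1
    · exact add_lt_add_of_lt_of_le (hcard' t hti (by rw [hm, h1])) (hcard w hwj)
    · exact add_lt_add_of_le_of_lt (hcard t hti) (hcard' w hwj (by rw [hm, h1])))
    (t - d) (w - d) (hnn t ht (min_le_left _ _)) (hnn w hw (min_le_right _ _))
    (fun k l hk hl => htc k l (hsupp t hti k hk) (hsupp t hti l hl))
    (fun k l hk hl => hwc k l (hsupp w hwj k hk) (hsupp w hwj l hl))
    (by simp [Finset.sum_sub_distrib, hsum])
    (fun u => by simp [Finset.sum_sub_distrib, sub_mul, h u]) rfl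
  exact sub_left_inj.mp key

/-! ### The faces of the permutahedron -/

section Faces

variable {n : ℕ} {x : Fin n → ℝ}

/-- The points of the convex hull of a finite family at which a linear functional is maximal are
the convex hull of the members at which it is maximal. -/
theorem convexHull_maximizers {ι E : Type*} [Fintype ι] [AddCommGroup E] [Module ℝ E]
    (p : ι → E) (l : E →ₗ[ℝ] ℝ) {i₀ : ι} (h₀ : ∀ i, l (p i) ≤ l (p i₀)) :
    {y ∈ convexHull ℝ (Set.range p) | ∀ z ∈ convexHull ℝ (Set.range p), l z ≤ l y} =
      convexHull ℝ (p '' {i | l (p i) = l (p i₀)}) := by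
  classical
  have hle : ∀ z ∈ convexHull ℝ (Set.range p), l z ≤ l (p i₀) := by
    intro z hz
    have : convexHull ℝ (Set.range p) ⊆ {z | l z ≤ l (p i₀)} :=
      convexHull_min (by rintro _ ⟨i, rfl⟩; exact h₀ i) (convex_halfSpace_le l.isLinear _)
    exact this hz
  have hmem : ∀ i, p i ∈ convexHull ℝ (Set.range p) := fun i => subset_convexHull ℝ _ ⟨i, rfl⟩
  apply Set.Subset.antisymm
  · rintro y ⟨hy, hmax⟩
    have hly : l y = l (p i₀) := le_antisymm (hle y hy) (hmax _ (hmem i₀))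
    rw [convexHull_range_eq_exists_affineCombination] at hy
    obtain ⟨s, w, hw0, hw1, rfl⟩ := hy
    rw [Finset.affineCombination_eq_linear_combination _ _ _ hw1] at hly ⊢
    have h2 : ∑ i ∈ s, w i * (l (p i₀) - l (p i)) = 0 := by
      simp only [mul_sub, Finset.sum_sub_distrib, ← Finset.sum_mul, hw1, one_mul]
      rw [← hly, map_sum]
      simp
    rw [Finset.sum_eq_zero_iff_of_nonneg fun i hi =>
      mul_nonneg (hw0 i hi) (sub_nonneg.mpr (h₀ i))] at h2
    have h3 : ∀ i ∈ s, w i ≠ 0 → l (p i) = l (p i₀) := fun i hi hw =>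
      (sub_eq_zero.mp ((mul_eq_zero.mp (h2 i hi)).resolve_left hw)).symm
    have h4 : ∀ f : ι → E, ∑ i ∈ s, w i • f i = ∑ i ∈ s.filter (fun i => w i ≠ 0), w i • f i := by
      intro f
      refine (Finset.sum_filter_of_ne (p := fun i => w i ≠ 0) fun i _ hi hw => hi (by rw [hw, zero_smul])).symm
    rw [h4]
    refine (convex_convexHull ℝ _).sum_mem (fun i hi => hw0 i (Finset.mem_filter.mp hi).1)
      ?_ (fun i hi => subset_convexHull ℝ _ ⟨i, ?_, rfl⟩)
    · rw [← hw1]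
      exact Finset.sum_filter_ne_zero s
    · exact h3 i (Finset.mem_filter.mp hi).1 (Finset.mem_filter.mp hi).2
  · refine convexHull_min ?_ ?_
    · rintro _ ⟨i, hi, rfl⟩
      exact ⟨hmem i, fun z hz => (hle z hz).trans_eq (Eq.symm hi)⟩
    · rintro y ⟨hy, hy'⟩ z ⟨hz, hz'⟩ a b ha hb hab
      refine ⟨convex_convexHull ℝ _ hy hz ha hb hab, fun v hv => ?_⟩
      have h1 : l y = l (p i₀) := le_antisymm (hle y hy) (hy' _ (hmem i₀))
      have h2 : l z = l (p i₀) := le_antisymm (hle z hz) (hz' _ (hmem i₀))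
      rw [map_add, map_smul, map_smul, h1, h2, ← add_smul, hab, one_smul]
      exact hle v hv

/-- Only the order of the coefficients of a functional matters for the vertices at which it is
maximal, so the level sets of the coefficients determine the face. -/
theorem permutahedron_maximizers (hx : Function.Injective x) (P : OrderedPartition n)
    (l : (Fin n → ℝ) →ₗ[ℝ] ℝ) (c : Fin n → ℝ) (hl : ∀ y, l y = ∑ a, c a * y a)
    (hc : ∀ a b, P.block a < P.block b ↔ c a < c b) :
    {y ∈ permutahedron x | ∀ z ∈ permutahedron x, l z ≤ l y} = P.face x := by
  obtain ⟨σ, hσ⟩ := exists_perm_monovary x c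
  rw [permutahedron, convexHull_maximizers (fun σ : Equiv.Perm (Fin n) => x ∘ σ) l (i₀ := σ),
    OrderedPartition.face]
  · congr 2
    ext τ
    simp only [Set.mem_ofPred_eq, hl, Finset.mem_coe, OrderedPartition.mem_perms, hc,
      Function.comp_apply]
    rw [sum_mul_perm_eq_iff hσ, monovary_comp_iff hx]
  · intro τ
    simp only [hl]
    exact sum_mul_perm_le hσ τ

namespace OrderedPartition

/-- The functional that sums the coordinates, weighted by the position of their blocks. -/
noncomputable def functional (P : OrderedPartition n) : (Fin n → ℝ) →ₗ[ℝ] ℝ :=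
  ∑ a, ((P.block a : ℕ) : ℝ) • LinearMap.proj a

theorem functional_apply (P : OrderedPartition n) (y : Fin n → ℝ) :
    P.functional y = ∑ a, ((P.block a : ℕ) : ℝ) * y a := by
  simp [functional]

theorem face_eq_maximizers (hx : Function.Injective x) (P : OrderedPartition n) :
    {y ∈ permutahedron x | ∀ z ∈ permutahedron x, P.functional z ≤ P.functional y} = P.face x :=
  permutahedron_maximizers hx P _ _ P.functional_apply fun _ _ => by simp

theorem comp_mem_face_iff (hx : Function.Injective x) (P : OrderedPartition n)
    (σ : Equiv.Perm (Fin n)) : x ∘ σ ∈ P.face x ↔ σ ∈ P.perms x := by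
  refine ⟨fun h => ?_, fun h => subset_convexHull ℝ _ ⟨σ, h, rfl⟩⟩
  rw [← face_eq_maximizers hx] at h
  obtain ⟨τ, hτ⟩ := P.perms_nonempty hx
  rw [mem_perms_iff_monovary hx] at hτ ⊢
  rw [← sum_mul_perm_eq_iff hτ]
  refine le_antisymm (sum_mul_perm_le hτ σ) ?_
  have := h.2 _ (comp_mem_permutahedron x τ)
  rwa [functional_apply, functional_apply] at this

/-- For the converse, suppose `P` separates two elements of one block of `Q`: exchanging their
values stays within the vertices for `Q` but violates the order required by `P`. -/
theorem le_iff_perms_subset (hx : Function.Injective x) {P Q : OrderedPartition n} :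
    P ≤ Q ↔ Q.perms x ⊆ P.perms x := by
  constructor
  · intro h σ hσ
    exact mem_perms.mpr fun a b hab => mem_perms.mp hσ a b (le_iff.mp h a b hab)
  · intro h
    refine le_of_isUpper fun U hU => ?_
    obtain ⟨σ, hσ⟩ := Q.perms_nonempty hx
    intro a b ha hb
    have hab := hU a b ha hb
    rcases lt_trichotomy (Q.block a) (Q.block b) with h2 | h2 | h2
    · exact h2
    · have h3 := mem_perms.mp (h (swap_mem_perms hσ h2)) a b hab
      simp only [Equiv.trans_apply, Equiv.swap_apply_left, Equiv.swap_apply_right] at h3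
      exact absurd h3 (mem_perms.mp (h hσ) a b hab).not_gt
    · exact absurd (mem_perms.mp hσ _ _ h2) (mem_perms.mp (h hσ) a b hab).not_gt

theorem face_anti (hx : Function.Injective x) {P Q : OrderedPartition n} (h : P ≤ Q) :
    Q.face x ⊆ P.face x :=
  convexHull_mono (Set.image_mono (Finset.coe_subset.mpr ((le_iff_perms_subset hx).mp h)))

theorem face_injective (hx : Function.Injective x) :
    Function.Injective fun P : OrderedPartition n => P.face x := by
  intro P Q h
  have h' : P.face x = Q.face x := h
  have : P.perms x = Q.perms x := by
    ext σ
    rw [← comp_mem_face_iff hx, ← comp_mem_face_iff hx, h']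
  exact le_antisymm ((le_iff_perms_subset hx).mpr this.ge)
    ((le_iff_perms_subset hx).mpr this.le)

theorem face_nonempty (hx : Function.Injective x) (P : OrderedPartition n) :
    (P.face x).Nonempty := by
  obtain ⟨σ, hσ⟩ := P.perms_nonempty hx
  exact ⟨_, (P.comp_mem_face_iff hx σ).mpr hσ⟩

/-- Block positions serve as coefficients of an exposing functional. Conversely, the level sets of
the coefficients `l (Pi.single a 1)` of an exposing functional `l` give the partition. -/
theorem bijOn_face (hx : Function.Injective x) :
    Set.BijOn (fun P : OrderedPartition n => P.face x) Set.univ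
      {F | F.Nonempty ∧ IsExposed ℝ (permutahedron x) F} := by
  refine ⟨fun P _ => ⟨P.face_nonempty hx, fun _ =>
    ⟨LinearMap.toContinuousLinearMap P.functional, (face_eq_maximizers hx P).symm⟩⟩,
    (face_injective hx).injOn, ?_⟩
  rintro F ⟨hne, hF⟩
  obtain ⟨l, rfl⟩ := hF hne
  obtain ⟨P, hP⟩ := exists_of_levels fun a => l (Pi.single a 1)
  refine ⟨P, trivial, (permutahedron_maximizers hx P l.toLinearMap _ (fun y => ?_) hP).symm⟩
  conv_lhs => rw [pi_eq_sum_univ' y, map_sum]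
  refine Finset.sum_congr rfl fun a _ => ?_
  rw [map_smul, smul_eq_mul, mul_comm]
  rfl

/-- The sums of the coordinates over the blocks. -/
noncomputable def blockSum (P : OrderedPartition n) : (Fin n → ℝ) →ₗ[ℝ] (Fin P.blocks → ℝ) :=
  LinearMap.pi fun i => ∑ a with P.block a = i, LinearMap.proj a

theorem blockSum_apply (P : OrderedPartition n) (y : Fin n → ℝ) (i : Fin P.blocks) :
    P.blockSum y i = ∑ a with P.block a = i, y a := by
  simp [blockSum]

theorem blockSum_single (P : OrderedPartition n) (a : Fin n) (r : ℝ) :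
    P.blockSum (Pi.single a r) = Pi.single (P.block a) r := by
  ext i
  rw [blockSum_apply, Finset.sum_filter]
  by_cases h : i = P.block a
  · subst h
    rw [Finset.sum_eq_single a]
    · simp
    · intro b _ hb
      simp [hb]
    · simp
  · rw [Pi.single_eq_of_ne h]
    refine Finset.sum_eq_zero fun b _ => ?_
    split_ifs with hb
    · rw [Pi.single_eq_of_ne]
      rintro rfl
      exact h hb.symm
    · rfl

theorem blockSum_surjective (P : OrderedPartition n) : Function.Surjective P.blockSum := by
  intro z
  refine ⟨∑ i, Pi.single (Function.surjInv P.surjective i) (z i), ?_⟩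
  simp only [map_sum, blockSum_single, Function.surjInv_eq P.surjective]
  exact Finset.univ_sum_single z

/-- A block is the difference of two consecutive final segments, and both are tight at all vertices
of the face. -/
theorem blockSum_perm_eq (hx : Function.Injective x) (P : OrderedPartition n)
    {σ τ : Equiv.Perm (Fin n)} (hσ : σ ∈ P.perms x) (hτ : τ ∈ P.perms x) :
    P.blockSum (x ∘ σ) = P.blockSum (x ∘ τ) := by
  classical
  have upper : ∀ U, P.IsUpper U → ∑ a ∈ U, x (σ a) = ∑ a ∈ U, x (τ a) := by
    intro U hU
    have h1 : ∀ σ ∈ P.perms x, slack x (x ∘ σ) U = 0 := fun σ hσ =>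
      (slack_perm_eq_zero_iff hx σ U).mpr fun a b ha hb => mem_perms.mp hσ a b (hU a b ha hb)
    have h2 := (h1 σ hσ).trans (h1 τ hτ).symm
    simpa [slack] using h2
  ext i
  have h1 := upper (Finset.univ.filter fun a => i < P.block a) fun a b ha hb => by
    simp only [Finset.mem_filter, Finset.mem_univ, true_and, not_lt] at ha hb
    exact lt_of_le_of_lt ha hb
  have h2 := upper (Finset.univ.filter fun a => i ≤ P.block a) fun a b ha hb => by
    simp only [Finset.mem_filter, Finset.mem_univ, true_and, not_le] at ha hb
    exact lt_of_lt_of_le ha hb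
  have h3 : ∀ y : Fin n → ℝ, ∑ a with i ≤ P.block a, y a =
      ∑ a with P.block a = i, y a + ∑ a with i < P.block a, y a := by
    intro y
    rw [← Finset.sum_union]
    · congr 1
      ext a
      simp only [Finset.mem_filter, Finset.mem_univ, true_and, Finset.mem_union]
      rw [le_iff_eq_or_lt, eq_comm]
    · rw [Finset.disjoint_filter]
      intro a _ h
      rw [h]
      exact lt_irrefl _
  rw [h3, h3] at h2
  simp only [blockSum_apply, Function.comp_apply]
  linarith

/-- Exchanging two values within a block moves a vertex by a nonzero multiple of a difference of
basis vectors, and these differences span the kernel of the block sums. Rank-nullity then gives the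
dimension. -/
theorem vectorSpan_face (hx : Function.Injective x) (P : OrderedPartition n) :
    vectorSpan ℝ (P.face x) = LinearMap.ker P.blockSum := by
  rw [face, ← direction_affineSpan, affineSpan_convexHull, direction_affineSpan]
  apply le_antisymm
  · rw [vectorSpan_def, Submodule.span_le]
    rintro _ ⟨_, ⟨σ, hσ, rfl⟩, _, ⟨τ, hτ, rfl⟩, rfl⟩
    simp only [vsub_eq_sub, SetLike.mem_coe, LinearMap.mem_ker, map_sub, sub_eq_zero]
    exact P.blockSum_perm_eq hx hσ hτ
  · set W := vectorSpan ℝ ((fun σ : Equiv.Perm (Fin n) => x ∘ σ) ''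
      (P.perms x : Set (Equiv.Perm (Fin n))))
    have hswap : ∀ a b, P.block a = P.block b →
        (Pi.single a 1 - Pi.single b 1 : Fin n → ℝ) ∈ W := by
      intro a b hab
      by_cases hne : a = b
      · subst hne
        simp
      obtain ⟨σ, hσ⟩ := P.perms_nonempty hx
      have h1 : x ∘ σ -ᵥ x ∘ ((Equiv.swap a b).trans σ) ∈ W :=
        vsub_mem_vectorSpan ℝ ⟨σ, hσ, rfl⟩ ⟨_, swap_mem_perms hσ hab, rfl⟩
      have h2 : x ∘ σ -ᵥ x ∘ ((Equiv.swap a b).trans σ) =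
          (x (σ a) - x (σ b)) • (Pi.single a 1 - Pi.single b 1 : Fin n → ℝ) := by
        ext c
        simp only [vsub_eq_sub, Pi.sub_apply, Function.comp_apply, Equiv.trans_apply,
          Pi.smul_apply, smul_eq_mul]
        by_cases hca : c = a
        · subst hca
          simp [hne]
        · by_cases hcb : c = b
          · subst hcb
            simp [hca]
          · simp [Equiv.swap_apply_of_ne_of_ne hca hcb, hca, hcb]
      have h3 : x (σ a) - x (σ b) ≠ 0 := sub_ne_zero.mpr fun h => hne (σ.injective (hx h))
      rw [h2] at h1
      exact (Submodule.smul_mem_iff _ h3).mp h1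
    intro y hy
    rw [LinearMap.mem_ker] at hy
    -- A chosen representative of the block of `a`; vanishing block sums allow each basis vector to
    -- be replaced by its difference from the representative's.
    let r : Fin n → Fin n := fun a => Function.surjInv P.surjective (P.block a)
    have hr : ∑ a, y a • (Pi.single (r a) 1 : Fin n → ℝ) = 0 := by
      rw [← Finset.sum_fiberwise Finset.univ P.block]
      refine Finset.sum_eq_zero fun i _ => ?_
      have : ∀ a ∈ Finset.univ.filter (fun a => P.block a = i),
          y a • (Pi.single (r a) 1 : Fin n → ℝ) =
          y a • (Pi.single (Function.surjInv P.surjective i) 1 : Fin n → ℝ) := by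
        intro a ha
        simp only [Finset.mem_filter, Finset.mem_univ, true_and] at ha
        simp only [r, ha]
      rw [Finset.sum_congr rfl this, ← Finset.sum_smul, ← blockSum_apply, hy]
      simp
    have hsum : y = ∑ a, y a • (Pi.single a 1 - Pi.single (r a) 1 : Fin n → ℝ) := by
      simp only [smul_sub, Finset.sum_sub_distrib, hr, sub_zero]
      exact pi_eq_sum_univ' y
    rw [hsum]
    exact Submodule.sum_mem _ fun a _ => Submodule.smul_mem _ _
      (hswap _ _ (Function.surjInv_eq P.surjective _).symm)

theorem finrank_face (hx : Function.Injective x) (P : OrderedPartition n) :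
    Module.finrank ℝ (vectorSpan ℝ (P.face x)) + P.blocks = n := by
  have h := LinearMap.finrank_range_add_finrank_ker P.blockSum
  rw [LinearMap.range_eq_top.mpr P.blockSum_surjective, finrank_top, Module.finrank_fin_fun,
    Module.finrank_fin_fun] at h
  rw [vectorSpan_face hx, add_comm]
  exact h

end OrderedPartition

theorem finrank_permutahedron (hx : Function.Injective x) :
    Module.finrank ℝ (vectorSpan ℝ (permutahedron x)) = n - 1 := by
  obtain ⟨P, hP⟩ := OrderedPartition.exists_of_levels (n := n) fun _ => (0 : ℕ)
  have hface : P.face x = permutahedron x := by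
    rw [OrderedPartition.face, permutahedron, ← Set.image_univ]
    congr 2
    ext σ
    simp only [Finset.mem_coe, OrderedPartition.mem_perms, hP, lt_self_iff_false, false_imp_iff,
      implies_true, Set.mem_univ]
  have hblocks : P.blocks ≤ 1 := by
    by_contra! h
    obtain ⟨a, ha⟩ := P.surjective ⟨0, by omega⟩
    obtain ⟨b, hb⟩ := P.surjective ⟨1, h⟩
    have := (hP a b).mp (by rw [ha, hb]; exact Nat.zero_lt_one)
    exact lt_irrefl _ this
  -- For `n = 0` the trivial partition has no block rather than one; the truncated `n - 1` is then
  -- `0`, which is the right dimension.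
  have h0 : P.blocks = 0 → n = 0 := by
    intro h
    by_contra hn
    have := (P.block ⟨0, Nat.pos_of_ne_zero hn⟩).isLt
    omega
  have := P.finrank_face hx
  rw [← hface]
  omega

end Faces

/-! ### Maps out of the realization of a simplicial set -/

section Realization

variable {K : SSet.{0}}

theorem toSSetObjEquiv_homEquiv {X : TopCat.{0}} (h : SSet.toTop.obj K ⟶ X) {n : ℕ}
    (s : K.obj (op (SimplexCategory.mk n))) (t : stdSimplex ℝ (Fin (n + 1))) :
    X.toSSetObjEquiv _ ((sSetTopAdj.homEquiv K X h).app (op (SimplexCategory.mk n)) s) t =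
      h (simplexPoint s t) := by
  have h1 := sSetTopAdj_unit_app_app_down K (op (SimplexCategory.mk n)) s
  rw [Adjunction.homEquiv_unit]
  change (((sSetTopAdj.unit.app K).app (op (SimplexCategory.mk n)) s).down ≫ h) (ULift.up t) = _
  rw [h1]
  rfl

theorem realization_hom_ext {X : TopCat.{0}} (f g : SSet.toTop.obj K ⟶ X)
    (h : ∀ (n : ℕ) (s : K.obj (op (SimplexCategory.mk n))) (t : stdSimplex ℝ (Fin (n + 1))),
      f (simplexPoint s t) = g (simplexPoint s t)) : f = g := by
  apply (sSetTopAdj.homEquiv K X).injective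
  ext n s
  induction n using Opposite.rec with | _ n
  induction n using SimplexCategory.rec with | _ n
  apply (X.toSSetObjEquiv _).injective
  ext t
  have h1 := h n s t
  rw [← toSSetObjEquiv_homEquiv, ← toSSetObjEquiv_homEquiv] at h1
  exact h1

/-- Every map to an indiscrete space is continuous. With `Prop` as such a space, the predicate "is a
point of some simplex" and the constant `True` agree on all simplices, hence everywhere. -/
theorem exists_simplexPoint (y : SSet.toTop.obj K) :
    ∃ (n : ℕ) (s : K.obj (op (SimplexCategory.mk n))) (t : stdSimplex ℝ (Fin (n + 1))),
      simplexPoint s t = y := by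
  let X : TopCat.{0} := @TopCat.of Prop ⊤
  have hc : ∀ f : SSet.toTop.obj K → Prop, @Continuous _ Prop _ ⊤ f := fun f =>
    continuous_top
  let f : SSet.toTop.obj K ⟶ X := @TopCat.ofHom _ Prop _ ⊤ (@ContinuousMap.mk _ Prop _ ⊤
    (fun y => ∃ (n : ℕ) (s : K.obj (op (SimplexCategory.mk n))) (t : stdSimplex ℝ (Fin (n + 1))),
      simplexPoint s t = y) (hc _))
  let g : SSet.toTop.obj K ⟶ X := @TopCat.ofHom _ Prop _ ⊤ (@ContinuousMap.mk _ Prop _ ⊤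
    (fun _ => True) (hc _))
  have hfg : f = g := realization_hom_ext f g fun n s t => eq_true ⟨n, s, t, rfl⟩
  have : f y = g y := by rw [hfg]
  exact of_eq_true this

theorem continuous_simplexPoint {n : ℕ} (s : K.obj (op (SimplexCategory.mk n))) :
    Continuous (simplexPoint s) :=
  (SSet.toTop.map (SSet.yonedaEquiv.symm s)).hom.continuous.comp
    (SimplexCategory.mk n).toTopHomeo.symm.continuous

theorem simplexPoint_map {n m : ℕ} (f : SimplexCategory.mk n ⟶ SimplexCategory.mk m)
    (s : K.obj (op (SimplexCategory.mk m))) (t : stdSimplex ℝ (Fin (n + 1))) :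
    simplexPoint (K.map f.op s) t = simplexPoint s (stdSimplex.map f t) := by
  have h1 : SSet.yonedaEquiv.symm (K.map f.op s) =
      SSet.stdSimplex.map f ≫ SSet.yonedaEquiv.symm s := by
    ext k α
    change K.map α.down.op (K.map f.op s) = K.map (α.down ≫ f).op s
    rw [op_comp, Functor.map_comp]
    rfl
  rw [simplexPoint, simplexPoint, h1, Functor.map_comp]
  have h2 := SimplexCategory.toTopHomeo_symm_naturality_apply.{0} f t
  erw [h2]
  rfl

/-- A compatible family is a simplicial map to the singular complex of `X`; its adjoint is the
required map. -/
theorem exists_realization_map {X : Type} [TopologicalSpace X]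
    (F : ∀ n, K.obj (op (SimplexCategory.mk n)) → stdSimplex ℝ (Fin (n + 1)) → X)
    (hF : ∀ n s, Continuous (F n s))
    (hnat : ∀ (n m : ℕ) (f : SimplexCategory.mk n ⟶ SimplexCategory.mk m) s t,
      F n (K.map f.op s) t = F m s (stdSimplex.map f t)) :
    ∃ h : SSet.toTop.obj K → X, Continuous h ∧
      ∀ n s (t : stdSimplex ℝ (Fin (n + 1))), h (simplexPoint s t) = F n s t := by
  let φ : K ⟶ TopCat.toSSet.obj (TopCat.of X) :=
    { app := fun n => ↾fun s => ((TopCat.of X).toSSetObjEquiv n).symm ⟨F n.unop.len s, hF _ _⟩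
      naturality := by
        intro m n f
        ext s
        apply ((TopCat.of X).toSSetObjEquiv n).injective
        ext t
        exact hnat n.unop.len m.unop.len f.unop s t }
  refine ⟨(sSetTopAdj.homEquiv K (TopCat.of X)).symm φ,
    ((sSetTopAdj.homEquiv K (TopCat.of X)).symm φ).hom.continuous, fun n s t => ?_⟩
  have := toSSetObjEquiv_homEquiv ((sSetTopAdj.homEquiv K (TopCat.of X)).symm φ) s t
  rw [Equiv.apply_symm_apply] at this
  exact this.symm

theorem simplexVertex_map {n m : ℕ} (f : SimplexCategory.mk n ⟶ SimplexCategory.mk m)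
    (s : K.obj (op (SimplexCategory.mk m))) (i : Fin (n + 1)) :
    simplexVertex (K.map f.op s) i = simplexVertex s (f i) := by
  have h : f.op ≫ (SimplexCategory.const (SimplexCategory.mk 0) (SimplexCategory.mk n) i).op =
      (SimplexCategory.const (SimplexCategory.mk 0) (SimplexCategory.mk m) (f i)).op := by
    rw [← op_comp]
    congr 1
  rw [simplexVertex, simplexVertex, ← h, Functor.map_comp]
  rfl

end Realization

/-! ### Order complexes and their realizations -/

section ChainComplex

/-- The weights of the vertices at a point of a simplex. -/
def vertexWeight {ι : Type} [DecidableEq ι] {n : ℕ} (v : Fin (n + 1) → ι) (t : stdSimplex ℝ (Fin (n + 1)))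
    (i : ι) : ℝ := ∑ k with v k = i, t k

section

variable {ι : Type} [DecidableEq ι] {n : ℕ} (v : Fin (n + 1) → ι) (t : stdSimplex ℝ (Fin (n + 1)))

theorem vertexWeight_nonneg (i : ι) : 0 ≤ vertexWeight v t i :=
  Finset.sum_nonneg fun k _ => t.2.1 k

theorem vertexWeight_sum [Fintype ι] : ∑ i, vertexWeight v t i = 1 := by
  rw [← t.2.2]
  exact Finset.sum_fiberwise _ _ _

theorem vertexWeight_smul_sum [Fintype ι] {E : Type*} [AddCommGroup E] [Module ℝ E] (b : ι → E) :
    ∑ i, vertexWeight v t i • b i = ∑ k, t k • b (v k) := by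
  rw [← Finset.sum_fiberwise Finset.univ v]
  refine Finset.sum_congr rfl fun i _ => ?_
  rw [vertexWeight, Finset.sum_smul]
  refine Finset.sum_congr rfl fun k hk => ?_
  rw [(Finset.mem_filter.mp hk).2]

theorem exists_of_vertexWeight_ne_zero {v : Fin (n + 1) → ι} {t : stdSimplex ℝ (Fin (n + 1))}
    {i : ι} (h : vertexWeight v t i ≠ 0) : ∃ k, v k = i := by
  obtain ⟨k, hk, -⟩ := Finset.exists_ne_zero_of_sum_ne_zero h
  exact ⟨k, (Finset.mem_filter.mp hk).2⟩

theorem vertexWeight_chain [PartialOrder ι] {v : Fin (n + 1) → ι} (hv : Monotone v)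
    (t : stdSimplex ℝ (Fin (n + 1))) (i j : ι) (hi : vertexWeight v t i ≠ 0)
    (hj : vertexWeight v t j ≠ 0) : i ≤ j ∨ j ≤ i := by
  obtain ⟨k, rfl⟩ := exists_of_vertexWeight_ne_zero hi
  obtain ⟨l, rfl⟩ := exists_of_vertexWeight_ne_zero hj
  exact (le_total k l).imp (fun h => hv h) (fun h => hv h)

theorem vertexWeight_apply {v : Fin (n + 1) → ι} (hv : Function.Injective v)
    (t : stdSimplex ℝ (Fin (n + 1))) (k : Fin (n + 1)) : vertexWeight v t (v k) = t k := by
  rw [vertexWeight, Finset.sum_eq_single k]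
  · intro l hl hlk
    exact absurd (hv (Finset.mem_filter.mp hl).2) hlk
  · simp

end

variable {K : SSet.{0}} {ι : Type} [PartialOrder ι] (e : K.obj (op (SimplexCategory.mk 0)) → ι)

/-- A simplicial set whose simplices are the chains of a partially ordered set: a simplex is
determined by its vertices, which form a monotone sequence, and all such sequences occur. -/
structure IsOrderComplex : Prop where
  ext : ∀ (n : ℕ) (s s' : K.obj (op (SimplexCategory.mk n))),
    (∀ i, e (simplexVertex s i) = e (simplexVertex s' i)) → s = s'
  mono : ∀ (n : ℕ) (s : K.obj (op (SimplexCategory.mk n))), Monotone fun i => e (simplexVertex s i)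
  exists_of_monotone : ∀ (n : ℕ) (c : Fin (n + 1) → ι), Monotone c →
    ∃ s : K.obj (op (SimplexCategory.mk n)), ∀ i, e (simplexVertex s i) = c i

variable {e}

theorem IsOrderComplex.eq_map (hK : IsOrderComplex e) {n m : ℕ}
    (f : SimplexCategory.mk n ⟶ SimplexCategory.mk m) (s : K.obj (op (SimplexCategory.mk n)))
    (s' : K.obj (op (SimplexCategory.mk m)))
    (h : ∀ i, e (simplexVertex s i) = e (simplexVertex s' (f i))) : s = K.map f.op s' :=
  hK.ext n _ _ fun i => by rw [h, simplexVertex_map]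

/-- Two consecutive vertices of a simplex that agree can be merged. -/
theorem IsOrderComplex.exists_degeneracy (hK : IsOrderComplex e) {n : ℕ}
    (s : K.obj (op (SimplexCategory.mk (n + 1)))) (k : Fin (n + 1))
    (h : e (simplexVertex s k.castSucc) = e (simplexVertex s k.succ)) :
    s = K.map (SimplexCategory.σ k).op (K.map (SimplexCategory.δ k.castSucc).op s) := by
  refine hK.eq_map _ _ _ fun i => ?_
  rw [simplexVertex_map]
  change e (simplexVertex s i) = e (simplexVertex s (k.castSucc.succAbove (k.predAbove i)))
  by_cases hi : i = k.castSucc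
  · subst hi
    rw [h]
    congr 2
    simp
  · rw [Fin.succAbove_predAbove hi]

theorem IsOrderComplex.strictMono (hK : IsOrderComplex e) {n : ℕ}
    {s : K.obj (op (SimplexCategory.mk n))} (hs : s ∈ K.nonDegenerate n) :
    StrictMono fun i => e (simplexVertex s i) := by
  cases n with
  | zero =>
    intro i j hij
    exact absurd (Subsingleton.elim (α := Fin 1) i j) hij.ne
  | succ n =>
    refine Fin.strictMono_iff_lt_succ.mpr fun k => lt_of_le_of_ne
      (hK.mono _ s (Fin.castSucc_lt_succ (i := k)).le) fun h => hs ?_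
    rw [hK.exists_degeneracy s k h]
    exact SSet.σ_mem_degenerate K k _

theorem stdSimplex_map_smul_sum {n m : ℕ} (f : Fin (n + 1) → Fin (m + 1))
    (t : stdSimplex ℝ (Fin (n + 1))) {E : Type*} [AddCommGroup E] [Module ℝ E]
    (b : Fin (m + 1) → E) :
    ∑ k, stdSimplex.map f t k • b k = ∑ k, t k • b (f k) := by
  rw [← Finset.sum_fiberwise Finset.univ f]
  refine Finset.sum_congr rfl fun i _ => ?_
  rw [stdSimplex.map_coe, FunOnFinite.linearMap_apply_apply, Finset.sum_smul]
  refine Finset.sum_congr rfl fun k hk => ?_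
  rw [(Finset.mem_filter.mp hk).2]

/-- A point whose coordinate at `k` vanishes lies in the face opposite to `k`. -/
theorem exists_stdSimplex_face {n : ℕ} (t : stdSimplex ℝ (Fin (n + 2))) (k : Fin (n + 2))
    (hk : t k = 0) : ∃ t' : stdSimplex ℝ (Fin (n + 1)), stdSimplex.map k.succAbove t' = t := by
  have hsum : ∑ i, t (k.succAbove i) = 1 := by
    have := t.2.2
    rw [Fin.sum_univ_succAbove _ k] at this
    change t k + _ = 1 at this
    rwa [hk, zero_add] at this
  refine ⟨⟨fun i => t (k.succAbove i), fun i => t.2.1 _, hsum⟩, ?_⟩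
  ext i
  rw [stdSimplex.map_coe, FunOnFinite.linearMap_apply_apply]
  by_cases hi : i = k
  · subst hi
    rw [Finset.sum_eq_zero]
    · exact hk.symm
    · intro j hj
      exact absurd (Finset.mem_filter.mp hj).2 (Fin.succAbove_ne i j)
  · obtain ⟨j, rfl⟩ := Fin.exists_succAbove_eq hi
    rw [Finset.sum_eq_single j]
    · rfl
    · intro l hl hlj
      exact absurd (Fin.succAbove_right_injective (Finset.mem_filter.mp hl).2) hlj
    · simp

/-- Every point of the realization lies in the interior of a simplex with distinct vertices. -/
theorem IsOrderComplex.exists_interior (hK : IsOrderComplex e) (y : SSet.toTop.obj K) :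
    ∃ (n : ℕ) (s : K.obj (op (SimplexCategory.mk n))) (t : stdSimplex ℝ (Fin (n + 1))),
      (StrictMono fun i => e (simplexVertex s i)) ∧ (∀ k, t k ≠ 0) ∧ simplexPoint s t = y := by
  classical
  -- A representative of least dimension is chosen: a repeated vertex or a vanishing coordinate
  -- would lower the dimension.
  have hex := exists_simplexPoint y
  obtain ⟨s, t, hst⟩ := Nat.find_spec hex
  have hmin : ∀ m (s' : K.obj (op (SimplexCategory.mk m))) t', simplexPoint s' t' = y →
      Nat.find hex ≤ m := fun m s' t' h => Nat.find_min' hex ⟨s', t', h⟩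
  generalize Nat.find hex = n at s t hst hmin
  refine ⟨n, s, t, ?_, ?_, hst⟩
  · cases n with
    | zero =>
      intro i j hij
      exact absurd (Subsingleton.elim (α := Fin 1) i j) hij.ne
    | succ n =>
      refine Fin.strictMono_iff_lt_succ.mpr fun k => lt_of_le_of_ne
        (hK.mono _ s (Fin.castSucc_lt_succ (i := k)).le) fun h => ?_
      have h1 := hK.exists_degeneracy s k h
      rw [h1, simplexPoint_map] at hst
      have := hmin n _ _ hst
      omega
  · intro k hk
    cases n with
    | zero =>
      have := t.2.2
      rw [Fin.sum_univ_one] at this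
      obtain rfl : k = 0 := Subsingleton.elim (α := Fin 1) _ _
      exact zero_ne_one (hk.symm.trans this)
    | succ n =>
      obtain ⟨t', rfl⟩ := exists_stdSimplex_face t k hk
      have h1 := simplexPoint_map (SimplexCategory.δ k) s t'
      have := hmin n _ _ (h1.trans hst)
      omega

variable [Fintype ι]

/-- Simplices with distinct vertices already cover the realization. Their dimension is below the
size of the poset, and each dimension has finitely many simplices. -/
theorem IsOrderComplex.compactSpace (hK : IsOrderComplex e) :
    CompactSpace (SSet.toTop.obj K) := by
  have hfin : ∀ n, Finite (K.obj (op (SimplexCategory.mk n))) := fun n =>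
    Finite.of_injective (fun s i => e (simplexVertex (n := n) s i)) fun s s' h =>
      hK.ext n s s' fun i => congrFun h i
  refine ⟨?_⟩
  have : (Set.univ : Set (SSet.toTop.obj K)) =
      ⋃ n ∈ Finset.range (Fintype.card ι), ⋃ s : K.obj (op (SimplexCategory.mk n)),
        Set.range (simplexPoint s) := by
    refine (Set.eq_univ_of_forall fun y => ?_).symm
    obtain ⟨n, s, t, hs, -, rfl⟩ := hK.exists_interior y
    have := Fintype.card_le_of_injective _ hs.injective
    rw [Fintype.card_fin] at this
    simp only [Set.mem_iUnion]
    exact ⟨n, Finset.mem_range.mpr this, s, t, rfl⟩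
  rw [this]
  exact (Finset.range _).isCompact_biUnion fun n _ =>
    isCompact_iUnion fun s => isCompact_range (continuous_simplexPoint s)

/-- The realization of the order complex of a partially ordered set is homeomorphic to a convex
set whose points are uniquely the convex combinations of the points assigned to the members of
a chain. -/
theorem IsOrderComplex.exists_homeomorph (hK : IsOrderComplex e) {d : ℕ} {P : Set (Fin d → ℝ)}
    (hP : Convex ℝ P) (b : ι → Fin d → ℝ) (hb : ∀ i, b i ∈ P)
    (hex : ∀ y ∈ P, ∃ w : ι → ℝ, (∀ i, 0 ≤ w i) ∧ ∑ i, w i = 1 ∧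
      (∀ i j, w i ≠ 0 → w j ≠ 0 → i ≤ j ∨ j ≤ i) ∧ ∑ i, w i • b i = y)
    (huniq : ∀ t w : ι → ℝ, (∀ i, 0 ≤ t i) → (∀ i, 0 ≤ w i) →
      (∀ i j, t i ≠ 0 → t j ≠ 0 → i ≤ j ∨ j ≤ i) → (∀ i j, w i ≠ 0 → w j ≠ 0 → i ≤ j ∨ j ≤ i) →
      ∑ i, t i = 1 → ∑ i, w i = 1 → ∑ i, t i • b i = ∑ i, w i • b i → t = w) :
    ∃ h : SSet.toTop.obj K ≃ₜ P, IsTriangulation h ∧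
      ∀ n s (t : stdSimplex ℝ (Fin (n + 1))),
        (h (simplexPoint s t) : Fin d → ℝ) = ∑ k, t k • b (e (simplexVertex s k)) := by
  classical
  let F : ∀ n, K.obj (op (SimplexCategory.mk n)) → stdSimplex ℝ (Fin (n + 1)) → P :=
    fun n s t => ⟨∑ k, t k • b (e (simplexVertex s k)),
      hP.sum_mem (fun k _ => t.2.1 k) t.2.2 fun k _ => hb _⟩
  obtain ⟨h, hcont, hh⟩ := exists_realization_map (K := K) F
    (fun n s => Continuous.subtype_mk (continuous_finsetSum _ fun k _ =>
      ((continuous_apply k).comp continuous_subtype_val).smul continuous_const) _)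
    (fun n m f s t => Subtype.ext (by
      simp only [F, simplexVertex_map]
      exact (stdSimplex_map_smul_sum f t fun k => b (e (simplexVertex s k))).symm))
  have hval : ∀ n s (t : stdSimplex ℝ (Fin (n + 1))),
      (h (simplexPoint s t) : Fin d → ℝ) =
        ∑ i, vertexWeight (fun k => e (simplexVertex s k)) t i • b i := by
    intro n s t
    rw [hh, vertexWeight_smul_sum]
  have hweight : ∀ n (s : K.obj (op (SimplexCategory.mk n))) (t : stdSimplex ℝ (Fin (n + 1))) m
      (s' : K.obj (op (SimplexCategory.mk m))) t', h (simplexPoint s t) = h (simplexPoint s' t') →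
      vertexWeight (fun k => e (simplexVertex s k)) t =
        vertexWeight (fun k => e (simplexVertex s' k)) t' := by
    intro n s t m s' t' heq
    refine huniq _ _ (vertexWeight_nonneg _ _) (vertexWeight_nonneg _ _)
      (vertexWeight_chain (hK.mono n s) t) (vertexWeight_chain (hK.mono m s') t')
      (vertexWeight_sum _ _) (vertexWeight_sum _ _) ?_
    rw [← hval, ← hval, heq]
  have hinj : Function.Injective h := by
    intro y z hyz
    obtain ⟨n, s, t, hs, ht, rfl⟩ := hK.exists_interior y
    obtain ⟨m, s', t', hs', ht', rfl⟩ := hK.exists_interior z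
    have hw := hweight _ _ _ _ _ _ hyz
    -- For an interior point the support of the weights is the vertex set, so equal weights give the
    -- same chain, hence the same simplex and coordinates.
    have hrange : Set.range (fun k => e (simplexVertex s k)) =
        Set.range (fun k => e (simplexVertex s' k)) := by
      apply Set.Subset.antisymm
      · rintro _ ⟨k, rfl⟩
        refine exists_of_vertexWeight_ne_zero (t := t') ?_
        rw [← hw]
        exact (vertexWeight_apply hs.injective t k).trans_ne (ht k)
      · rintro _ ⟨k, rfl⟩
        refine exists_of_vertexWeight_ne_zero (t := t) ?_
        rw [hw]
        exact (vertexWeight_apply hs'.injective t' k).trans_ne (ht' k)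
    have hnm : n = m := by
      have h1 := Set.ncard_range_of_injective hs.injective
      have h2 := Set.ncard_range_of_injective hs'.injective
      rw [hrange, h2] at h1
      simpa using h1.symm
    subst hnm
    have hv := (StrictMono.range_inj hs hs').mp hrange
    obtain rfl := hK.ext n s s' fun i => congrFun hv i
    congr 1
    ext k
    have h1 := vertexWeight_apply hs.injective t k
    have h2 := vertexWeight_apply hs.injective t' k
    rw [← h1, ← h2, hw]
  have hsurj : Function.Surjective h := by
    rintro ⟨y, hy⟩
    obtain ⟨w, hw0, hw1, hwc, rfl⟩ := hex y hy
    -- The support is a nonempty chain; listed in increasing order it is the vertex sequence of the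
    -- simplex that contains the preimage.
    let S : Finset ι := Finset.univ.filter fun i => w i ≠ 0
    have hS : 0 < S.card := by
      by_contra h0
      have h1 : S = ∅ := Finset.card_eq_zero.mp (by omega)
      have h2 : ∑ i, w i = ∑ i ∈ S, w i := (Finset.sum_filter_ne_zero _).symm
      rw [h1, hw1, Finset.sum_empty] at h2
      exact one_ne_zero h2
    obtain ⟨n, hn⟩ : ∃ n, S.card = n + 1 := ⟨S.card - 1, by omega⟩
    let _ : LinearOrder S := { (inferInstance : PartialOrder S) with
      le_total := fun i j => hwc i j (Finset.mem_filter.mp i.2).2 (Finset.mem_filter.mp j.2).2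
      toDecidableLE := Classical.decRel _ }
    let c : Fin (n + 1) ≃o S := Fintype.orderIsoFinOfCardEq S (by rw [Fintype.card_coe, hn])
    obtain ⟨s, hs⟩ := hK.exists_of_monotone n (fun k => c k) fun i j hij => c.monotone hij
    have hsum : ∀ {E : Type} [AddCommGroup E] [Module ℝ E] (f : ι → E),
        ∑ k, w (c k) • f (c k) = ∑ i, w i • f i := by
      intro E _ _ f
      rw [Fintype.sum_equiv c.toEquiv (fun k => w (c k) • f (c k))
        (fun i : S => w i • f i) fun _ => rfl, Finset.sum_coe_sort S fun i => w i • f i]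
      refine Finset.sum_filter_of_ne fun i _ hi hwi => hi ?_
      rw [hwi, zero_smul]
    refine ⟨simplexPoint s ⟨fun k => w (c k), fun k => hw0 _, ?_⟩, Subtype.ext ?_⟩
    · have := hsum fun _ => (1 : ℝ)
      simpa [hw1] using this
    · rw [hh]
      change ∑ k, w (c k) • b (e (simplexVertex s k)) = _
      simp only [hs]
      exact hsum b
  have := hK.compactSpace
  let H : SSet.toTop.obj K ≃ₜ P :=
    Continuous.homeoOfEquivCompactToT2 (f := Equiv.ofBijective h ⟨hinj, hsurj⟩) hcont
  have hH : ∀ n s (t : stdSimplex ℝ (Fin (n + 1))),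
      (H (simplexPoint s t) : Fin d → ℝ) = ∑ k, t k • b (e (simplexVertex s k)) := by
    intro n s t
    exact congrArg Subtype.val (hh n s t)
  refine ⟨H, ⟨fun n s => ⟨(∑ k, (LinearMap.proj k).smulRight
    (b (e (simplexVertex s k)))).toAffineMap, fun t => ?_⟩, fun n s hs t t' htt => ?_⟩, hH⟩
  · rw [hH]
    simp
  · have hw := hweight n s t n s t' htt
    ext k
    have h1 := vertexWeight_apply (hK.strictMono hs).injective t k
    have h2 := vertexWeight_apply (hK.strictMono hs).injective t' k
    rw [← h1, ← h2, hw]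

end ChainComplex

/-! ### Reduced paths and free categories -/

section Reduced

variable {C D : Type} [SmallCategory C] [SmallCategory D]

theorem isNonIdentity_id (a : C) : ¬ IsNonIdentity (𝟙 a) := fun h => h ⟨rfl, rfl⟩

theorem pathReduced_comp {a b : C} (p : Quiver.Path a b) {c : C} (q : Quiver.Path b c) :
    PathReduced (p.comp q) ↔ PathReduced p ∧ PathReduced q := by
  induction q with
  | nil => simp [PathReduced]
  | cons q e ih =>
    rw [Quiver.Path.comp_cons]
    change PathReduced (p.comp q) ∧ _ ↔ _ ∧ PathReduced q ∧ _
    rw [ih, and_assoc]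

/-- The path of length at most one that represents a morphism. -/
noncomputable def letterPath {a b : C} (e : a ⟶ b) : Quiver.Path a b :=
  open Classical in
  if h : ∃ h : a = b, e = eqToHom h then h.choose ▸ Quiver.Path.nil else e.toPath

theorem letterPath_id (a : C) : letterPath (𝟙 a) = Quiver.Path.nil := by
  rw [letterPath, dif_pos ⟨rfl, rfl⟩]

theorem letterPath_of_isNonIdentity {a b : C} {e : a ⟶ b} (h : IsNonIdentity e) :
    letterPath e = e.toPath := dif_neg h

/-- The functor that represents each morphism of the free category by its reduced path. -/
noncomputable def normalForm (C : Type) [SmallCategory C] : Cat.FreeRefl C ⥤ Paths C :=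
  Cat.FreeRefl.lift
    { obj := fun a => a
      map := fun e => letterPath e
      map_id := fun a => letterPath_id a }

/-- The morphism of the free category represented by a path. -/
def freeWord {a b : C} (p : Quiver.Path a b) : Cat.FreeRefl.mk a ⟶ Cat.FreeRefl.mk b :=
  (Cat.FreeRefl.quotientFunctor C).map p

theorem freeWord_nil (a : C) : freeWord (Quiver.Path.nil : Quiver.Path a a) = 𝟙 _ :=
  Cat.FreeRefl.quotientFunctor_map_nil a

theorem freeWord_cons {a b c : C} (p : Quiver.Path a b) (e : b ⟶ c) :
    freeWord (p.cons e) = freeWord p ≫ Cat.FreeRefl.homMk e := rfl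

theorem freeWord_comp {a b c : C} (p : Quiver.Path a b) (q : Quiver.Path b c) :
    freeWord (p.comp q) = freeWord p ≫ freeWord q :=
  (Cat.FreeRefl.quotientFunctor C).map_comp p q

/-- The normal form only deletes identity letters, and a reduced path has none. This makes reduced
representatives unique. -/
theorem normalForm_freeWord {a b : C} (p : Quiver.Path a b) (hp : PathReduced p) :
    (normalForm C).map (freeWord p) = p := by
  induction p with
  | nil => exact (normalForm C).map_id _
  | cons p e ih =>
    rw [freeWord_cons, Functor.map_comp, ih hp.1]
    have : (normalForm C).map (Cat.FreeRefl.homMk e) = letterPath e := Cat.FreeRefl.lift_map _ _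
    rw [this, letterPath_of_isNonIdentity hp.2]
    rfl

theorem freeWord_injective {a b : C} {p q : Quiver.Path a b} (hp : PathReduced p)
    (hq : PathReduced q) (h : freeWord p = freeWord q) : p = q := by
  rw [← normalForm_freeWord p hp, h, normalForm_freeWord q hq]

theorem exists_freeWord {a b : C} (f : Cat.FreeRefl.mk a ⟶ Cat.FreeRefl.mk b) :
    ∃ p : Quiver.Path a b, PathReduced p ∧ freeWord p = f := by
  obtain ⟨p, rfl⟩ := (Cat.FreeRefl.quotientFunctor C).map_surjective f
  change ∃ q : Quiver.Path a b, _ ∧ freeWord q = freeWord p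
  change Quiver.Path a b at p
  induction p with
  | nil => exact ⟨.nil, trivial, rfl⟩
  | cons p e ih =>
    obtain ⟨q, hq, hqp⟩ := ih
    by_cases he : IsNonIdentity e
    · exact ⟨q.cons e, ⟨hq, he⟩, by rw [freeWord_cons, hqp]; rfl⟩
    · obtain ⟨rfl, rfl⟩ := not_not.mp he
      refine ⟨q, hq, hqp.trans ?_⟩
      have : freeWord (p.cons (𝟙 _)) = freeWord p := by
        rw [freeWord_cons]
        exact (congrArg (freeWord p ≫ ·) (Cat.FreeRefl.homMk_id _)).trans (Category.comp_id _)
      exact this.symm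

/-- The counit of the free category comonad: composition of the letters. -/
def wordEval (C : Type) [SmallCategory C] : Cat.FreeRefl C ⥤ C := Cat.FreeRefl.lift (𝟭rq C)

theorem wordEval_freeWord {a b : C} (p : Quiver.Path a b) :
    (wordEval C).map (freeWord p) = composePath p := by
  induction p with
  | nil => exact (wordEval C).map_id _
  | cons p e ih =>
    rw [freeWord_cons, Functor.map_comp, ih, composePath_cons]
    have : (wordEval C).map (Cat.FreeRefl.homMk e) = e := Cat.FreeRefl.lift_map _ _
    rw [this]
    rfl

theorem wordEval_obj_bijective : Function.Bijective (wordEval C).obj := by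
  refine ⟨fun a b h => ?_, fun a => ⟨Cat.FreeRefl.mk a, rfl⟩⟩
  induction a with | _ a
  induction b with | _ b
  have : a = b := h
  rw [this]

/-- The functor between free categories induced by a functor. -/
def wordMap (F : D ⥤ C) : Cat.FreeRefl D ⥤ Cat.FreeRefl C := Cat.freeReflMap F.toReflPrefunctor

theorem wordMap_freeWord (F : D ⥤ C) {a b : D} (p : Quiver.Path a b) :
    (wordMap F).map (freeWord p) = freeWord (F.toPrefunctor.mapPath p) := by
  induction p with
  | nil => exact (wordMap F).map_id _
  | cons p e ih =>
    rw [freeWord_cons, Functor.map_comp, ih, Prefunctor.mapPath_cons, freeWord_cons]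
    rfl

theorem wordMap_comp {E : Type} [SmallCategory E] (F : D ⥤ C) (H : C ⥤ E) :
    wordMap (F ⋙ H) = wordMap F ⋙ wordMap H :=
  congrArg Cat.Hom.toFunctor (Cat.freeRefl.map_comp
    (ReflQuiv.forget.map F.toCatHom) (ReflQuiv.forget.map H.toCatHom))

theorem wordMap_obj_bijective {F : D ⥤ C} (hF : Function.Bijective F.obj) :
    Function.Bijective (wordMap F).obj := by
  refine ⟨fun a b h => ?_, fun c => ?_⟩
  · induction a with | _ a
    induction b with | _ b
    have h1 : F.obj a = F.obj b := congrArg (wordEval C).obj h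
    rw [hF.1 h1]
  · induction c with | _ c
    obtain ⟨a, rfl⟩ := hF.2 c
    exact ⟨Cat.FreeRefl.mk a, rfl⟩

/-! ### Graded categories: uniqueness of cuts in words -/

/-- A grading of a category: every morphism that is not an identity lowers the degree. -/
def IsGrading (r : C → ℕ) : Prop := ∀ ⦃a b : C⦄ (f : a ⟶ b), IsNonIdentity f → r b < r a

theorem IsGrading.degree_add_length_le {r : C → ℕ} (hr : IsGrading r) {a b : C}
    (p : Quiver.Path a b) (hp : PathReduced p) : r b + p.length ≤ r a := by
  induction p with
  | nil => simp
  | cons p e ih =>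
    have h1 := ih hp.1
    have h2 := hr e hp.2
    rw [Quiver.Path.length_cons]
    omega

theorem IsGrading.eq_nil {r : C → ℕ} (hr : IsGrading r) {a : C} {p : Quiver.Path a a}
    (hp : PathReduced p) : p = .nil := by
  have := hr.degree_add_length_le p hp
  exact Quiver.Path.eq_nil_of_length_zero p (by omega)

theorem IsGrading.eq_nil_of_isNonIdentity {r : C → ℕ} (hr : IsGrading r) {a : C} (f : a ⟶ a) :
    f = 𝟙 a := by
  by_contra h
  exact lt_irrefl _ (hr f fun ⟨_, h'⟩ => h h')

theorem IsGrading.freeRefl {r : C → ℕ} (hr : IsGrading r) :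
    IsGrading fun a : Cat.FreeRefl C => r ((wordEval C).obj a) := by
  intro a b f hf
  induction a with | _ a
  induction b with | _ b
  obtain ⟨p, hp, rfl⟩ := exists_freeWord f
  change r b < r a
  cases p with
  | nil => exact absurd hf (freeWord_nil a ▸ isNonIdentity_id _)
  | cons p e =>
    have := hr.degree_add_length_le _ hp
    rw [Quiver.Path.length_cons] at this
    omega

/-- The drop in degree is visible on the image objects, so they differ. Hence the induced functor on
words deletes no letters of reduced words. -/
theorem IsGrading.isNonIdentity_map {r : C → ℕ} {F : D ⥤ C}
    (hr : IsGrading fun a => r (F.obj a)) {a b : D} {f : a ⟶ b} (hf : IsNonIdentity f) :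
    IsNonIdentity (F.map f) := by
  rintro ⟨h, -⟩
  have : r (F.obj b) < r (F.obj a) := hr f hf
  rw [h] at this
  exact lt_irrefl _ this

theorem IsGrading.pathReduced_mapPath {r : C → ℕ} {F : D ⥤ C}
    (hr : IsGrading fun a => r (F.obj a)) {a b : D} {p : Quiver.Path a b} (hp : PathReduced p) :
    PathReduced (F.toPrefunctor.mapPath p) := by
  induction p with
  | nil => trivial
  | cons p e ih => exact ⟨ih hp.1, hr.isNonIdentity_map hp.2⟩

/-- Both cuts are at the same object `b`, and reduced loops are trivial, so neither tail can return
to `b` after the other has left it. -/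
theorem IsGrading.comp_inj {r : C → ℕ} (hr : IsGrading r) {a b c : C} {p p' : Quiver.Path a b}
    {q q' : Quiver.Path b c} (hq : PathReduced q) (hq' : PathReduced q')
    (h : p.comp q = p'.comp q') : p = p' ∧ q = q' := by
  induction q with
  | nil =>
    obtain rfl := hr.eq_nil hq'
    exact ⟨h, rfl⟩
  | cons q e ih =>
    cases q' with
    | nil => exact absurd (hr.eq_nil hq) (Quiver.Path.cons_ne_nil _ _)
    | cons q' e' =>
      rw [Quiver.Path.comp_cons, Quiver.Path.comp_cons] at h
      obtain rfl := Quiver.Path.obj_eq_of_cons_eq_cons h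
      obtain rfl := eq_of_heq (Quiver.Path.hom_heq_of_cons_eq_cons h)
      obtain ⟨h1, h2⟩ := ih hq.1 hq'.1 (eq_of_heq (Quiver.Path.heq_of_cons_eq_cons h))
      exact ⟨h1, by rw [h2]⟩

/-- A factorization of a morphism of the free category on a graded category is determined by the
intermediate object. -/
theorem IsGrading.freeRefl_comp_inj {r : C → ℕ} (hr : IsGrading r) {a b c : Cat.FreeRefl C}
    {f f' : a ⟶ b} {g g' : b ⟶ c} (h : f ≫ g = f' ≫ g') : f = f' ∧ g = g' := by
  induction a with | _ a
  induction b with | _ b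
  induction c with | _ c
  obtain ⟨p, hp, rfl⟩ := exists_freeWord f
  obtain ⟨p', hp', rfl⟩ := exists_freeWord f'
  obtain ⟨q, hq, rfl⟩ := exists_freeWord g
  obtain ⟨q', hq', rfl⟩ := exists_freeWord g'
  rw [← freeWord_comp, ← freeWord_comp] at h
  obtain ⟨rfl, rfl⟩ := hr.comp_inj hq hq' (freeWord_injective ((pathReduced_comp _ _).mpr ⟨hp, hq⟩)
    ((pathReduced_comp _ _).mpr ⟨hp', hq'⟩) h)
  exact ⟨rfl, rfl⟩

/-- A morphism of `F U D` is determined by its composite and its image in `F U C`. -/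
theorem freeRefl_hom_ext {r : C → ℕ} {F : D ⥤ C} (hr : IsGrading fun a => r (F.obj a))
    (hF : Function.Injective F.obj)
    (hD : ∀ {a b c : D} {f f' : a ⟶ b} {g g' : b ⟶ c}, f ≫ g = f' ≫ g' → f = f' ∧ g = g')
    {a b : Cat.FreeRefl D} {f g : a ⟶ b} (hmap : (wordMap F).map f = (wordMap F).map g)
    (heval : (wordEval D).map f = (wordEval D).map g) : f = g := by
  induction a with | _ a
  induction b with | _ b
  obtain ⟨p, hp, rfl⟩ := exists_freeWord f
  obtain ⟨q, hq, rfl⟩ := exists_freeWord g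
  rw [wordMap_freeWord, wordMap_freeWord] at hmap
  replace hmap := freeWord_injective (hr.pathReduced_mapPath hp) (hr.pathReduced_mapPath hq) hmap
  rw [wordEval_freeWord, wordEval_freeWord] at heval
  congr 1
  induction p with
  | nil => exact (hr.eq_nil hq).symm
  | cons p e ih =>
    cases q with
    | nil => exact hr.eq_nil hp
    | cons q e' =>
      rw [Prefunctor.mapPath_cons, Prefunctor.mapPath_cons] at hmap
      -- The equal images force the last letters to start at the same object; unique factorization
      -- through this object then splits the equality of composites.
      obtain rfl := hF (Quiver.Path.obj_eq_of_cons_eq_cons hmap)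
      have h1 := eq_of_heq (Quiver.Path.heq_of_cons_eq_cons hmap)
      rw [composePath_cons, composePath_cons] at heval
      obtain ⟨h2, rfl⟩ := hD heval
      rw [ih hp.1 q hq.1 h2 h1]

/-! ### Lifting of factorizations along functors of free categories -/

theorem Quiver.Path.eq_of_comp_eq_comp {V : Type*} [Quiver V] {a b b' c : V}
    {p : Quiver.Path a b} {q : Quiver.Path b c} {p' : Quiver.Path a b'} {q' : Quiver.Path b' c}
    (h : p.comp q = p'.comp q') (hl : q.length = q'.length) : b = b' := by
  induction q with
  | nil => exact (Quiver.Path.eq_of_length_zero q' hl.symm).symm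
  | cons q e ih =>
    cases q' with
    | nil => simp at hl
    | cons q' e' =>
      rw [Quiver.Path.comp_cons, Quiver.Path.comp_cons] at h
      obtain rfl := Quiver.Path.obj_eq_of_cons_eq_cons h
      exact ih (eq_of_heq (Quiver.Path.heq_of_cons_eq_cons h)) (by simpa using hl)

theorem Prefunctor.length_mapPath {V W : Type*} [Quiver V] [Quiver W] (F : V ⥤q W) {a b : V}
    (p : Quiver.Path a b) : (F.mapPath p).length = p.length := by
  induction p with
  | nil => rfl
  | cons p e ih => simp [ih]

/-- Factorizations of paths lift along prefunctors. -/
theorem Prefunctor.exists_of_mapPath_eq_comp {V W : Type*} [Quiver V] [Quiver W] (F : V ⥤q W)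
    (hF : Function.Injective F.obj) {a b c : V} (p : Quiver.Path a b)
    (q₁ : Quiver.Path (F.obj a) (F.obj c)) (q₂ : Quiver.Path (F.obj c) (F.obj b))
    (h : F.mapPath p = q₁.comp q₂) :
    ∃ (p₁ : Quiver.Path a c) (p₂ : Quiver.Path c b),
      p = p₁.comp p₂ ∧ F.mapPath p₁ = q₁ ∧ F.mapPath p₂ = q₂ := by
  have hlen : p.length = q₁.length + q₂.length := by
    rw [← Prefunctor.length_mapPath F p, h, Quiver.Path.length_comp]
  obtain ⟨c', p₁, p₂, hp, hl⟩ := p.exists_eq_comp_of_le_length (n := q₁.length) (by omega)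
  have hl₂ : p₂.length = q₂.length := by
    have := congrArg Quiver.Path.length hp
    rw [Quiver.Path.length_comp] at this
    omega
  have h' := h
  rw [hp, Prefunctor.mapPath_comp] at h'
  obtain rfl := hF (Quiver.Path.eq_of_comp_eq_comp h' (by rw [Prefunctor.length_mapPath, hl₂]))
  obtain ⟨h1, h2⟩ := (Quiver.Path.comp_inj (by rw [Prefunctor.length_mapPath, hl₂])).mp h'
  exact ⟨p₁, p₂, hp, h1, h2⟩

/-- Factorizations lift along functors between free categories. -/
theorem wordMap_exists_lift {r : C → ℕ} {F : D ⥤ C} (hr : IsGrading fun a => r (F.obj a))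
    (hF : Function.Injective F.obj) {a b c : Cat.FreeRefl D} (f : a ⟶ b)
    (g₁ : (wordMap F).obj a ⟶ (wordMap F).obj c) (g₂ : (wordMap F).obj c ⟶ (wordMap F).obj b)
    (h : (wordMap F).map f = g₁ ≫ g₂) :
    ∃ (f₁ : a ⟶ c) (f₂ : c ⟶ b), f = f₁ ≫ f₂ ∧ (wordMap F).map f₁ = g₁ ∧
      (wordMap F).map f₂ = g₂ := by
  induction a with | _ a
  induction b with | _ b
  induction c with | _ c
  obtain ⟨p, hp, rfl⟩ := exists_freeWord f
  obtain ⟨q₁, hq₁, rfl⟩ := exists_freeWord (a := F.obj a) (b := F.obj c) g₁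
  obtain ⟨q₂, hq₂, rfl⟩ := exists_freeWord (a := F.obj c) (b := F.obj b) g₂
  rw [wordMap_freeWord] at h
  have h' := freeWord_injective (hr.pathReduced_mapPath hp)
    ((pathReduced_comp _ _).mpr ⟨hq₁, hq₂⟩) (h.trans (freeWord_comp _ _).symm)
  obtain ⟨p₁, p₂, rfl, rfl, rfl⟩ := F.toPrefunctor.exists_of_mapPath_eq_comp hF p q₁ q₂ h'
  exact ⟨freeWord p₁, freeWord p₂, freeWord_comp _ _, wordMap_freeWord F p₁,
    wordMap_freeWord F p₂⟩

/-- Paths whose composite lifts to a morphism lift to paths with this composite. -/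
theorem exists_lift_path {H : D ⥤ C} (hH : Function.Bijective H.obj)
    (hid : ∀ (a : D) (f : a ⟶ a), f = 𝟙 a)
    (hlift : ∀ {a b c : D} (f : a ⟶ b) (g₁ : H.obj a ⟶ H.obj c) (g₂ : H.obj c ⟶ H.obj b),
      H.map f = g₁ ≫ g₂ → ∃ (f₁ : a ⟶ c) (f₂ : c ⟶ b), f = f₁ ≫ f₂ ∧ H.map f₁ = g₁ ∧
        H.map f₂ = g₂)
    {a : D} {y : C} (p : Quiver.Path (H.obj a) y) {b : D} (hb : y = H.obj b) (f : a ⟶ b)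
    (h : H.map f = composePath p ≫ eqToHom hb) :
    ∃ P : Quiver.Path a b, composePath P = f ∧ H.toPrefunctor.mapPath P = p.cast rfl hb := by
  induction p generalizing b with
  | nil =>
    obtain rfl := hH.1 hb
    exact ⟨.nil, (hid _ f).symm, rfl⟩
  | @cons z y p e ih =>
    obtain ⟨c, rfl⟩ := hH.2 z
    subst hb
    rw [eqToHom_refl, Category.comp_id, composePath_cons] at h
    obtain ⟨f₁, f₂, rfl, h1, rfl⟩ := hlift f _ _ h
    obtain ⟨P, hP, hP'⟩ := ih rfl f₁ (by rw [h1, eqToHom_refl, Category.comp_id])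
    exact ⟨P.cons f₂, by rw [composePath_cons, hP], by rw [Prefunctor.mapPath_cons, hP']; rfl⟩

/-- The square of `F U` applied to a functor between free categories and of the counit is a weak
pullback. -/
theorem exists_wordMap_wordEval {H : D ⥤ C} (hH : Function.Bijective H.obj)
    (hid : ∀ (a : D) (f : a ⟶ a), f = 𝟙 a)
    (hlift : ∀ {a b c : D} (f : a ⟶ b) (g₁ : H.obj a ⟶ H.obj c) (g₂ : H.obj c ⟶ H.obj b),
      H.map f = g₁ ≫ g₂ → ∃ (f₁ : a ⟶ c) (f₂ : c ⟶ b), f = f₁ ≫ f₂ ∧ H.map f₁ = g₁ ∧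
        H.map f₂ = g₂)
    (f : Arrow D) (w : Arrow (Cat.FreeRefl C))
    (h : H.mapArrow.obj f = (wordEval C).mapArrow.obj w) :
    ∃ u : Arrow (Cat.FreeRefl D), (wordMap H).mapArrow.obj u = w ∧
      (wordEval D).mapArrow.obj u = f := by
  obtain ⟨a, b, f⟩ := f
  obtain ⟨x, y, w⟩ := w
  induction x with | _ x
  induction y with | _ y
  obtain ⟨p, -, rfl⟩ := exists_freeWord w
  have hx : H.obj a = x := congrArg Comma.left h
  have hy : H.obj b = y := congrArg Comma.right h
  subst hx hy
  have hf : H.map f = composePath p := by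
    have := (Arrow.mk_inj _ _).mp (show Arrow.mk (H.map f) = Arrow.mk _ from h)
    rw [this]
    exact wordEval_freeWord p
  obtain ⟨P, rfl, rfl⟩ := exists_lift_path hH hid hlift p rfl f
    (by rw [hf, eqToHom_refl, Category.comp_id])
  refine ⟨Arrow.mk (freeWord P), ?_, ?_⟩
  · exact congrArg Arrow.mk (wordMap_freeWord H P)
  · exact congrArg Arrow.mk (wordEval_freeWord P)

end Reduced

/-! ### Simplices of the free resolution and their vertices -/

section Vertices

section Bar

variable {B : Type*} [Category B] (G : Comonad B) (X : B)

/-- The map that takes a constant value. -/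
def monoConst (n : ℕ) {m : ℕ} (i : Fin m) : Fin n →o Fin m := ⟨fun _ => i, fun _ _ _ => le_rfl⟩

theorem barMap_const_zero (n : ℕ) :
    barMap G X 1 (n + 1) (monoConst 1 0) = comonadApply G (barMap G X 0 n (monoEmpty n)) := by
  rw [barMap_of_eq G X _ rfl]
  have : monoTail (monoConst 1 (0 : Fin (n + 1))) = monoEmpty (n + 1) := by
    ext i
    exact i.elim0
  rw [this, barMap_zero_succ, comonadApply_comp, ← Category.assoc, comonadComul_apply_counit,
    Category.id_comp]

theorem barMap_const_succ (n : ℕ) (i : Fin (n + 1)) :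
    barMap G X 1 (n + 2) (monoConst 1 i.succ) =
      comonadCounit G X (n + 1) ≫ barMap G X 1 (n + 1) (monoConst 1 i) :=
  barMap_of_pred G X _ _ fun _ => rfl

theorem barMap_empty_succ (n : ℕ) :
    barMap G X 0 (n + 1) (monoEmpty (n + 1)) =
      comonadApply G (barMap G X 0 n (monoEmpty n)) ≫ comonadCounit G X 0 := by
  rw [barMap_zero_succ, comonadCounit_naturality]

end Bar

variable {C : Type} [SmallCategory C]

/-- The iterated free category `(F U) ^ n C`. -/
abbrev iterFree (C : Type) [SmallCategory C] (n : ℕ) : Cat.{0, 0} :=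
  comonadIter freeComonad (Cat.of C) n

/-- The composition of all letters. -/
def iterEval (C : Type) [SmallCategory C] (n : ℕ) : iterFree C n ⥤ C :=
  (barMap freeComonad (Cat.of C) 0 n (monoEmpty n)).toFunctor

/-- The composition of all letters but those of one level. -/
def iterVertex (C : Type) [SmallCategory C] (n : ℕ) (i : Fin (n + 1)) :
    iterFree C (n + 1) ⥤ Cat.FreeRefl C :=
  (barMap freeComonad (Cat.of C) 1 (n + 1) (monoConst 1 i)).toFunctor

theorem iterVertex_zero (n : ℕ) : iterVertex C n 0 = wordMap (iterEval C n) :=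
  congrArg Cat.Hom.toFunctor (barMap_const_zero freeComonad (Cat.of C) n)

theorem iterVertex_succ (n : ℕ) (i : Fin (n + 1)) :
    iterVertex C (n + 1) i.succ = wordEval (iterFree C (n + 1)) ⋙ iterVertex C n i :=
  congrArg Cat.Hom.toFunctor (barMap_const_succ freeComonad (Cat.of C) n i)

theorem iterEval_succ (n : ℕ) : iterEval C (n + 1) = wordEval (iterFree C n) ⋙ iterEval C n :=
  congrArg Cat.Hom.toFunctor (barMap_zero_succ freeComonad (Cat.of C) n _)

theorem iterEval_succ' (n : ℕ) : iterEval C (n + 1) = wordMap (iterEval C n) ⋙ wordEval C :=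
  congrArg Cat.Hom.toFunctor (barMap_empty_succ freeComonad (Cat.of C) n)

theorem iterEval_zero : iterEval C 0 = 𝟭 C := by
  rw [iterEval, barMap]
  rfl

theorem iterEval_one : iterEval C 1 = wordEval C := by
  rw [iterEval_succ, iterEval_zero]
  rfl

theorem iterVertex_zero_zero : iterVertex C 0 0 = 𝟭 _ :=
  congrArg Cat.Hom.toFunctor ((congrArg (barMap freeComonad (Cat.of C) 1 1) (by
    ext i; exact congrArg Fin.val (Subsingleton.elim (α := Fin 1) _ _))).trans
    (barMap_id freeComonad (Cat.of C) 1))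

theorem iterEval_obj_bijective (n : ℕ) : Function.Bijective (iterEval C n).obj := by
  induction n with
  | zero =>
    rw [iterEval_zero]
    exact Function.bijective_id
  | succ n ih =>
    rw [iterEval_succ]
    exact ih.comp wordEval_obj_bijective

variable {r : C → ℕ}

theorem IsGrading.iterFree (hr : IsGrading r) (n : ℕ) :
    IsGrading fun a : iterFree C n => r ((iterEval C n).obj a) := by
  induction n with
  | zero =>
    rw [iterEval_zero]
    exact hr
  | succ n ih =>
    rw [iterEval_succ]
    exact ih.freeRefl

theorem IsGrading.iterFree_comp_inj (hr : IsGrading r) (n : ℕ) {a b c : _root_.iterFree C (n + 1)}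
    {f f' : a ⟶ b} {g g' : b ⟶ c} (h : f ≫ g = f' ≫ g') : f = f' ∧ g = g' :=
  (hr.iterFree n).freeRefl_comp_inj h

/-- A simplex is determined by its vertices. -/
theorem IsGrading.iterFree_hom_ext (hr : IsGrading r) (n : ℕ) {a b : _root_.iterFree C (n + 1)}
    (f g : a ⟶ b) (h : ∀ i, (iterVertex C n i).map f = (iterVertex C n i).map g) : f = g := by
  induction n with
  | zero =>
    have := h 0
    rw [iterVertex_zero_zero] at this
    exact this
  | succ n ih =>
    -- Vertex `0` keeps the outermost brackets and composes everything inside. The remaining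
    -- vertices are those of the concatenation, to which induction applies.
    refine freeRefl_hom_ext (hr.iterFree (n + 1)) (iterEval_obj_bijective (n + 1)).1
      (hr.iterFree_comp_inj n) ?_ (ih _ _ fun i => ?_)
    · have := h 0
      rw [iterVertex_zero] at this
      exact this
    · have := h i.succ
      rw [iterVertex_succ] at this
      exact this

/-- The word `q` is obtained from the word `p` by factoring the letters. -/
def IsSubdivision (p q : Arrow (Cat.FreeRefl C)) : Prop :=
  ∃ w : Arrow (Cat.FreeRefl (Cat.FreeRefl C)),
    (wordMap (wordEval C)).mapArrow.obj w = p ∧ (wordEval (Cat.FreeRefl C)).mapArrow.obj w = q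

/-- All sequences of subdivisions are sequences of vertices. -/
theorem IsGrading.exists_iterVertex (hr : IsGrading r) (n : ℕ)
    (v : Fin (n + 1) → Arrow (Cat.FreeRefl C))
    (hv : ∀ i : Fin n, IsSubdivision (v i.castSucc) (v i.succ)) :
    ∃ f : Arrow (_root_.iterFree C (n + 1)), ∀ i, (iterVertex C n i).mapArrow.obj f = v i := by
  induction n with
  | zero =>
    refine ⟨v 0, fun i => ?_⟩
    obtain rfl : i = 0 := Subsingleton.elim (α := Fin 1) _ _
    rw [iterVertex_zero_zero]
    rfl
  | succ n ih =>
    -- `f` realizes all vertices but the first. The subdivision `w` of the first into the second is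
    -- glued to `f` along their common vertex by the weak pullback property.
    obtain ⟨f, hf⟩ := ih (fun i => v i.succ) fun i => hv i.succ
    obtain ⟨w, hw, hw'⟩ := hv 0
    have h0 := hf 0
    rw [iterVertex_zero] at h0
    obtain ⟨u, hu, hu'⟩ := exists_wordMap_wordEval
      (H := wordMap (iterEval C n)) (wordMap_obj_bijective (iterEval_obj_bijective n))
      (fun a f => (hr.iterFree n).freeRefl.eq_nil_of_isNonIdentity f)
      (fun f g₁ g₂ h => wordMap_exists_lift (hr.iterFree n) (iterEval_obj_bijective n).1 f g₁ g₂ h)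
      f w (h0.trans hw'.symm)
    refine ⟨u, fun i => ?_⟩
    induction i using Fin.cases with
    | zero =>
      rw [iterVertex_zero, iterEval_succ']
      exact (congrArg (fun H : Cat.FreeRefl (Cat.FreeRefl _) ⥤ _ => H.mapArrow.obj u)
        (wordMap_comp (wordMap (iterEval C n)) (wordEval C))).trans
        ((congrArg (wordMap (wordEval C)).mapArrow.obj hu).trans hw)
    | succ i =>
      rw [iterVertex_succ, ← hf, ← hu']
      rfl

end Vertices

section Component

variable {C : Type} [SmallCategory C]

/-! ### The decomposition of the mapping spaces -/

theorem iterEval_degObj (x : C) (n : SimplexCategoryᵒᵖ) :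
    (iterEval C (n.unop.len + 1)).obj (degObj (DK (Cat.of C)) (DK.of x) n) = x := by
  have h := comonadAugmentation_naturality freeComonad (Cat.of C)
    (SimplexCategory.const n.unop (SimplexCategory.mk 0) 0).op
  have h1 := congrArg (fun F => F.toFunctor.obj (DK.of x)) h
  refine (show (iterEval C (n.unop.len + 1)).obj _ = (iterEval C 1).obj (DK.of x) from h1).trans ?_
  rw [iterEval_one (C := C)]
  rfl

variable {x y : C}

theorem mem_DKComponent_iff {θ : x ⟶ y} {n : SimplexCategoryᵒᵖ} {φ : (DKMap x y).obj n} :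
    φ ∈ (DKComponent θ).obj n ↔
      (iterEval C (n.unop.len + 1)).mapArrow.obj φ.1 = Arrow.mk θ := Iff.rfl

theorem existsUnique_mem_DKComponent {n : SimplexCategoryᵒᵖ} (φ : (DKMap x y).obj n) :
    ∃! θ : x ⟶ y, φ ∈ (DKComponent θ).obj n := by
  simp only [mem_DKComponent_iff]
  have hl : ((iterEval C (n.unop.len + 1)).mapArrow.obj φ.1).left = x :=
    (congrArg (iterEval C (n.unop.len + 1)).obj φ.2.1).trans (iterEval_degObj x n)
  have hr : ((iterEval C (n.unop.len + 1)).mapArrow.obj φ.1).right = y :=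
    (congrArg (iterEval C (n.unop.len + 1)).obj φ.2.2).trans (iterEval_degObj y n)
  generalize (iterEval C (n.unop.len + 1)).mapArrow.obj φ.1 = ψ at hl hr
  obtain ⟨a, b, f⟩ := ψ
  obtain rfl : a = x := hl
  obtain rfl : b = y := hr
  exact ⟨f, rfl, fun g hg => ((Arrow.mk_inj _ _).mp hg).symm⟩

/-- A mapping space of the free resolution is the disjoint union of its parts that lie over the
different morphisms. -/
theorem nonempty_isColimit_DKComponent (x y : C) :
    Nonempty (Limits.IsColimit (Limits.Cofan.mk (DKMap x y)
      fun θ : x ⟶ y => (DKComponent θ).ι)) := by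
  choose θ hθ hθ' using fun (n : SimplexCategoryᵒᵖ) (φ : (DKMap x y).obj n) =>
    existsUnique_mem_DKComponent φ
  let desc : ∀ s : Limits.Cofan (fun θ : x ⟶ y => (DKComponent θ).toSSet), ∀ n,
    (DKMap x y).obj n → s.pt.obj n := fun s n φ => (s.inj (θ n φ)).app n ⟨φ, hθ n φ⟩
  have hdesc : ∀ s n φ (τ : x ⟶ y) (h : φ ∈ (DKComponent τ).obj n),
      desc s n φ = (s.inj τ).app n ⟨φ, h⟩ := by
    intro s n φ τ h
    obtain rfl := hθ' n φ τ h
    rfl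
  refine ⟨Limits.Cofan.IsColimit.mk _ (fun s =>
    { app := fun n => ↾(desc s n)
      naturality := fun n k f => ?_ }) (fun s τ => ?_) (fun s m hm => ?_)⟩
  · ext φ
    change desc s k ((DKMap x y).map f φ) = s.pt.map f (desc s n φ)
    rw [hdesc s k _ (θ n φ) ((DKComponent (θ n φ)).map f (hθ n φ)), hdesc s n φ _ (hθ n φ)]
    exact ConcreteCategory.congr_hom ((s.inj (θ n φ)).naturality f) ⟨φ, hθ n φ⟩
  · ext n φ
    exact hdesc s n φ.1 τ φ.2
  · ext n φ
    change m.app n φ = desc s n φ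
    have := congrArg (fun F => F.app n ⟨φ, hθ n φ⟩) (hm (θ n φ))
    exact this

/-! ### The vertices of the simplices of the mapping spaces -/

/-- Holds by definition: the operator for the `i`-th vertex acts on the resolution through the
constant map with value `i`. -/
theorem simplexVertex_coe {θ : x ⟶ y} {n : ℕ}
    (s : (DKComponent θ).toSSet.obj (op (SimplexCategory.mk n))) (i : Fin (n + 1)) :
    (simplexVertex s i).1.1 = (iterVertex C n i).mapArrow.obj s.1.1 := rfl

theorem degObj_zero (x : C) :
    degObj (DK (Cat.of C)) (DK.of x) (op (SimplexCategory.mk 0)) = Cat.FreeRefl.mk x := by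
  have : (SimplexCategory.const (SimplexCategory.mk 0) (SimplexCategory.mk 0) 0).op = 𝟙 _ :=
    Quiver.Hom.unop_inj (Subsingleton.elim _ _)
  rw [degObj, this, CategoryTheory.Functor.map_id]
  rfl

theorem iterVertex_degObj (x : C) (n : ℕ) (i : Fin (n + 1)) :
    (iterVertex C n i).obj (degObj (DK (Cat.of C)) (DK.of x) (op (SimplexCategory.mk n))) =
      Cat.FreeRefl.mk x :=
  (map_degObj (DK (Cat.of C)) (DK.of x)
    (SimplexCategory.const (SimplexCategory.mk 0) (SimplexCategory.mk n) i).op).trans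
    (degObj_zero x)

theorem iterEval_eq_iterVertex (n : ℕ) (i : Fin (n + 1)) :
    iterEval C (n + 1) = iterVertex C n i ⋙ wordEval C := by
  rw [← iterEval_one (C := C)]
  exact congrArg Cat.Hom.toFunctor (comonadAugmentation_naturality freeComonad (Cat.of C)
    (SimplexCategory.const (SimplexCategory.mk 0) (SimplexCategory.mk n) i).op).symm

variable {r : C → ℕ}

/-- A simplex of a mapping space is determined by its vertices. -/
theorem IsGrading.simplex_ext (hr : IsGrading r) {θ : x ⟶ y} {n : ℕ}
    (s s' : (DKComponent θ).toSSet.obj (op (SimplexCategory.mk n)))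
    (h : ∀ i, simplexVertex s i = simplexVertex s' i) : s = s' := by
  have h' : ∀ i, (iterVertex C n i).mapArrow.obj s.1.1 = (iterVertex C n i).mapArrow.obj s'.1.1 :=
    fun i => by rw [← simplexVertex_coe, h, simplexVertex_coe]
  obtain ⟨⟨⟨a, b, f⟩, hl, hr₁⟩, hs⟩ := s
  obtain ⟨⟨⟨a', b', f'⟩, hl', hr₁'⟩, hs'⟩ := s'
  dsimp only at h'
  obtain rfl : a = a' := hl.trans hl'.symm
  obtain rfl : b = b' := hr₁.trans hr₁'.symm
  obtain rfl : f = f' := hr.iterFree_hom_ext n f f' fun i => (Arrow.mk_inj _ _).mp (h' i)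
  rfl

/-- Consecutive vertices of a simplex are related by subdivision. -/
theorem isSubdivision_simplexVertex {θ : x ⟶ y} {n : ℕ}
    (s : (DKComponent θ).toSSet.obj (op (SimplexCategory.mk n))) (i k : Fin (n + 1))
    (hik : i ≤ k) : IsSubdivision (C := C) (simplexVertex s i).1.1 (simplexVertex s k).1.1 := by
  -- The edge from `i` to `k` is a word of words, and this is the witness of the subdivision.
  let g : SimplexCategory.mk 1 ⟶ SimplexCategory.mk n := SimplexCategory.mkOfLe i k hik
  have h0 : simplexVertex ((DKComponent θ).toSSet.map g.op s) 0 = simplexVertex s i :=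
    simplexVertex_map g s 0
  have h1 : simplexVertex ((DKComponent θ).toSSet.map g.op s) 1 = simplexVertex s k :=
    simplexVertex_map g s 1
  rw [← h0, ← h1, simplexVertex_coe, simplexVertex_coe]
  refine ⟨((DKComponent θ).toSSet.map g.op s).1.1, ?_, ?_⟩
  · rw [iterVertex_zero, iterEval_one (C := C)]
    rfl
  · rw [show (1 : Fin 2) = Fin.succ 0 from rfl, iterVertex_succ, iterVertex_zero_zero]
    rfl

/-- Every sequence of subdivisions of words for `θ` is the sequence of vertices of a simplex. -/
theorem IsGrading.exists_simplex (hr : IsGrading r) {θ : x ⟶ y} {n : ℕ}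
    (v : Fin (n + 1) → (DKComponent θ).toSSet.obj (op (SimplexCategory.mk 0)))
    (hv : ∀ i : Fin n, IsSubdivision (C := C) (v i.castSucc).1.1 (v i.succ).1.1) :
    ∃ s : (DKComponent θ).toSSet.obj (op (SimplexCategory.mk n)),
      ∀ i, simplexVertex s i = v i := by
  obtain ⟨f, hf⟩ := hr.exists_iterVertex n (fun i => (v i).1.1) hv
  have hinj : Function.Injective (iterVertex C n 0).obj := by
    rw [iterVertex_zero]
    exact (wordMap_obj_bijective (iterEval_obj_bijective n)).1
  have hl : f.left = degObj (DK (Cat.of C)) (DK.of x) (op (SimplexCategory.mk n)) :=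
    hinj (((congrArg Comma.left (hf 0)).trans ((v 0).1.2.1.trans (degObj_zero x))).trans
      (iterVertex_degObj x n 0).symm)
  have hr : f.right = degObj (DK (Cat.of C)) (DK.of y) (op (SimplexCategory.mk n)) :=
    hinj (((congrArg Comma.right (hf 0)).trans ((v 0).1.2.2.trans (degObj_zero y))).trans
      (iterVertex_degObj y n 0).symm)
  have hθ : (iterEval C (n + 1)).mapArrow.obj f = Arrow.mk θ := by
    have h1 : (iterEval C 1).mapArrow.obj (v 0).1.1 = Arrow.mk θ := (v 0).2
    rw [iterEval_eq_iterVertex n 0, ← h1, ← hf 0, iterEval_one (C := C)]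
    rfl
  exact ⟨⟨⟨f, hl, hr⟩, hθ⟩, fun i => Subtype.ext (Subtype.ext (hf i))⟩

/-- The vertices of the part of the mapping space over `θ` are the factorizations of `θ`. -/
theorem exists_vertexEquiv (θ : x ⟶ y) :
    ∃ V : Factorization θ ≃ (DKComponent θ).toSSet.obj (op (SimplexCategory.mk 0)),
      ∀ φ, (V φ).1.1 = pathToFree φ.1 := by
  have hmem : ∀ p : Quiver.Path x y, (iterEval C 1).mapArrow.obj (pathToFree (C := C) p) = Arrow.mk θ ↔
      composePath p = θ := by
    intro p
    rw [iterEval_one (C := C), ← wordEval_freeWord p]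
    exact Arrow.mk_inj _ _
  let V : Factorization θ → (DKComponent θ).toSSet.obj (op (SimplexCategory.mk 0)) := fun φ =>
    ⟨⟨pathToFree (C := C) φ.1, (degObj_zero x).symm, (degObj_zero y).symm⟩,
      (hmem φ.1).mpr φ.2.1⟩
  have hV : ∀ φ, (V φ).1.1 = pathToFree φ.1 := fun φ => rfl
  refine ⟨Equiv.ofBijective V ⟨fun φ ψ h => ?_, fun v => ?_⟩, hV⟩
  · have h1 : pathToFree φ.1 = pathToFree ψ.1 := by
      rw [← hV, ← hV]
      exact congrArg (fun v => v.1.1) h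
    exact Subtype.ext (freeWord_injective φ.2.2 ψ.2.2 ((Arrow.mk_inj _ _).mp h1))
  · obtain ⟨⟨⟨a, b, f⟩, hl, hr⟩, hs⟩ := v
    obtain rfl : a = Cat.FreeRefl.mk x := hl.trans (degObj_zero x)
    obtain rfl : b = Cat.FreeRefl.mk y := hr.trans (degObj_zero y)
    obtain ⟨p, hp, rfl⟩ := exists_freeWord f
    exact ⟨⟨p, (hmem p).mp hs, hp⟩, rfl⟩

end Component

/-! ### Factorizations in the opposite of the restricted simplex category -/

namespace PlusDelta

variable {x y z : PlusDeltaᵒᵖ}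

/-- The image of the injection given by a morphism. -/
def image (f : x ⟶ y) : Set (Fin x.unop.card) := Set.range (emb f.unop)

theorem emb_comp (f : x ⟶ y) (g : y ⟶ z) (a : Fin z.unop.card) :
    emb (f ≫ g).unop a = emb f.unop (emb g.unop a) := rfl

theorem image_comp_subset (f : x ⟶ y) (g : y ⟶ z) : image (f ≫ g) ⊆ image f := by
  rintro _ ⟨a, rfl⟩
  exact ⟨emb g.unop a, rfl⟩

theorem hom_ext {f g : x ⟶ y} (h : ∀ a, emb f.unop a = emb g.unop a) : f = g :=
  Quiver.Hom.unop_inj (RelEmbedding.ext h)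

theorem comp_left_cancel {f : x ⟶ y} {g g' : y ⟶ z} (h : f ≫ g = f ≫ g') : g = g' := by
  refine hom_ext fun a => (emb f.unop).injective ?_
  rw [← emb_comp, h, emb_comp]

theorem obj_ext (h : x.unop.card = y.unop.card) : x = y := by
  obtain ⟨⟨n⟩⟩ := x
  obtain ⟨⟨m⟩⟩ := y
  obtain rfl : n = m := h
  rfl

theorem obj_eq_of_image_eq {f : x ⟶ y} {g : x ⟶ z} (h : image f = image g) : y = z := by
  have h1 := Set.ncard_range_of_injective (emb f.unop).injective
  have h2 := Set.ncard_range_of_injective (emb g.unop).injective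
  refine obj_ext ?_
  change (image f).ncard = _ at h1
  change (image g).ncard = _ at h2
  rw [h, h2] at h1
  simpa using h1.symm

theorem hom_eq_of_image_eq {f g : x ⟶ y} (h : image f = image g) : f = g :=
  Quiver.Hom.unop_inj (OrderEmbedding.range_inj.mp h)

theorem exists_image_eq (S : Set (Fin x.unop.card)) :
    ∃ (y : PlusDeltaᵒᵖ) (f : x ⟶ y), image f = S := by
  classical
  let f : Fin S.toFinset.card ↪o Fin x.unop.card := S.toFinset.orderEmbOfFin rfl
  refine ⟨op ⟨S.toFinset.card⟩, Quiver.Hom.op (V := PlusDelta) f, ?_⟩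
  have := Finset.range_orderEmbOfFin S.toFinset rfl
  rw [Set.coe_toFinset] at this
  exact this

theorem exists_comp_eq {f : x ⟶ y} {g : x ⟶ z} (h : image g ⊆ image f) :
    ∃ e : y ⟶ z, f ≫ e = g := by
  choose u hu using fun a => h ⟨a, rfl⟩
  let e : Fin z.unop.card ↪o Fin y.unop.card := OrderEmbedding.ofMapLEIff u fun a b => by
    rw [← (emb f.unop).le_iff_le, hu, hu, (emb g.unop).le_iff_le]
  exact ⟨Quiver.Hom.op (V := PlusDelta) e, hom_ext hu⟩

/-- A strictly increasing map between ordinals of the same size is the identity. -/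
theorem isGrading : IsGrading fun x : PlusDeltaᵒᵖ => x.unop.card := by
  intro x y f hf
  have h1 := Fintype.card_le_of_injective _ (emb f.unop).injective
  simp only [Fintype.card_fin] at h1
  refine lt_of_le_of_ne h1 fun h => hf ?_
  obtain rfl := obj_ext h
  refine ⟨rfl, hom_eq_of_image_eq ?_⟩
  have h2 := Finite.surjective_of_injective (emb f.unop).injective
  exact h2.range_eq.trans (Finite.surjective_of_injective (emb (𝟙 y : y ⟶ y).unop).injective).range_eq.symm

theorem exists_notMem_image {f : x ⟶ y} (hf : IsNonIdentity f) : ∃ a, a ∉ image f := by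
  by_contra! h
  have h1 := Fintype.card_le_of_surjective (emb f.unop) h
  simp only [Fintype.card_fin] at h1
  exact absurd (isGrading f hf) (not_lt.mpr h1)

end PlusDelta

open PlusDelta

/-! ### Level functions of factorizations -/

section MissCount

variable {x : PlusDeltaᵒᵖ}

theorem missCount_cons {y z : PlusDeltaᵒᵖ} (p : Quiver.Path x y) (e : y ⟶ z)
    (a : Fin x.unop.card) [Decidable (a ∈ image (composePath (p.cons e)))] :
    missCount (p.cons e) a =
      missCount p a + if a ∈ image (composePath (p.cons e)) then 0 else 1 := by
  rw [missCount]
  congr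

/-- The images of the partial composites decrease, so an element of the last image lies in all of
them. -/
theorem missCount_eq_zero_iff {y : PlusDeltaᵒᵖ} (p : Quiver.Path x y) (a : Fin x.unop.card) :
    missCount p a = 0 ↔ a ∈ image (composePath p) := by
  classical
  induction p with
  | nil => exact ⟨fun _ => ⟨a, rfl⟩, fun _ => rfl⟩
  | cons p e ih =>
    rw [missCount_cons, Nat.add_eq_zero_iff, ih]
    refine ⟨fun h => ?_, fun h => ⟨image_comp_subset _ _ h, if_pos h⟩⟩
    by_contra h1
    rw [if_neg h1] at h
    exact absurd h.2 one_ne_zero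

theorem missCount_comp_of_notMem {y z : PlusDeltaᵒᵖ} (p : Quiver.Path x y) (q : Quiver.Path y z)
    {a : Fin x.unop.card} (ha : a ∉ image (composePath p)) :
    missCount (p.comp q) a = missCount p a + q.length := by
  classical
  induction q with
  | nil => rfl
  | cons q e ih =>
    have h1 : a ∉ image (composePath ((p.comp q).cons e)) := fun h => ha (by
      rw [composePath_cons, composePath_comp, Category.assoc] at h
      exact image_comp_subset _ _ h)
    rw [Quiver.Path.comp_cons, missCount_cons, ih, if_neg h1, Quiver.Path.length_cons, add_assoc]

theorem missCount_comp_le {y z : PlusDeltaᵒᵖ} (p : Quiver.Path x y) (q : Quiver.Path y z)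
    {a : Fin x.unop.card} (ha : a ∈ image (composePath p)) :
    missCount (p.comp q) a ≤ q.length := by
  classical
  induction q with
  | nil => exact ((missCount_eq_zero_iff p a).mpr ha).le
  | cons q e ih =>
    rw [Quiver.Path.comp_cons, missCount_cons, Quiver.Path.length_cons]
    split_ifs <;> omega

theorem missCount_le_length {y : PlusDeltaᵒᵖ} (p : Quiver.Path x y) (a : Fin x.unop.card) :
    missCount p a ≤ p.length := by
  have := missCount_comp_le Quiver.Path.nil p (a := a) ⟨a, rfl⟩
  rwa [Quiver.Path.nil_comp] at this

/-- The images of the partial composites are the sublevel sets of the level function, which is how a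
path is recovered from it. -/
theorem mem_image_iff_missCount_comp_le {y z : PlusDeltaᵒᵖ} (p : Quiver.Path x y)
    (q : Quiver.Path y z) (a : Fin x.unop.card) :
    a ∈ image (composePath p) ↔ missCount (p.comp q) a ≤ q.length := by
  refine ⟨missCount_comp_le p q, fun h => ?_⟩
  by_contra ha
  rw [missCount_comp_of_notMem p q ha] at h
  exact ha ((missCount_eq_zero_iff p a).mp (by omega))

theorem exists_missCount_eq {y : PlusDeltaᵒᵖ} (p : Quiver.Path x y) (hp : PathReduced p) {i : ℕ}
    (hi : i < p.length) : ∃ a, missCount p a = i + 1 := by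
  classical
  induction p generalizing i with
  | nil => exact absurd hi (Nat.not_lt_zero i)
  | cons p e ih =>
    cases i with
    | zero =>
      obtain ⟨b, hb⟩ := exists_notMem_image hp.2
      refine ⟨emb (composePath p).unop b, ?_⟩
      rw [missCount_cons, (missCount_eq_zero_iff p _).mpr ⟨b, rfl⟩, if_neg]
      rintro ⟨c, hc⟩
      rw [composePath_cons, emb_comp] at hc
      exact hb ⟨c, (emb (composePath p).unop).injective hc⟩
    | succ i =>
      rw [Quiver.Path.length_cons] at hi
      obtain ⟨a, ha⟩ := ih hp.1 (i := i) (by omega)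
      refine ⟨a, ?_⟩
      rw [missCount_cons, ha, if_neg]
      intro h
      have := (missCount_eq_zero_iff p a).mpr (image_comp_subset _ _ h)
      omega

theorem mem_image_iff_missCount_cons_le {y z : PlusDeltaᵒᵖ} (p : Quiver.Path x y) (e : y ⟶ z)
    (a : Fin x.unop.card) : a ∈ image (composePath p) ↔ missCount (p.cons e) a ≤ 1 :=
  mem_image_iff_missCount_comp_le p e.toPath a

/-- The levels at most `1` form the image before the last letter. This image fixes the last
intermediate object and the morphism to it; cancelling that morphism gives the last letter. -/
theorem eq_of_missCount_eq {y : PlusDeltaᵒᵖ} {p q : Quiver.Path x y} (hp : PathReduced p)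
    (hq : PathReduced q) (hcomp : composePath p = composePath q)
    (h : ∀ a, missCount p a = missCount q a) : p = q := by
  classical
  induction p with
  | nil => exact (isGrading.eq_nil hq).symm
  | cons p e ih =>
    cases q with
    | nil => exact isGrading.eq_nil hp
    | cons q e' =>
      have him : image (composePath p) = image (composePath q) := by
        ext a
        rw [mem_image_iff_missCount_cons_le p e, mem_image_iff_missCount_cons_le q e', h]
      obtain rfl := obj_eq_of_image_eq him
      have hpq := hom_eq_of_image_eq him
      have hcomp' := hcomp
      rw [composePath_cons, composePath_cons, hpq] at hcomp'
      obtain rfl := comp_left_cancel hcomp'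
      rw [ih hp.1 hq.1 hpq fun a => ?_]
      have := h a
      rw [missCount_cons, missCount_cons, hcomp] at this
      omega

theorem exists_path_of_levels (k : ℕ) {y : PlusDeltaᵒᵖ} (θ : x ⟶ y) (μ : Fin x.unop.card → ℕ)
    (h0 : ∀ a, μ a = 0 ↔ a ∈ image θ) (hle : ∀ a, μ a ≤ k)
    (hex : ∀ i < k, ∃ a, μ a = i + 1) :
    ∃ p : Quiver.Path x y, composePath p = θ ∧ PathReduced p ∧ p.length = k ∧
      ∀ a, missCount p a = μ a := by
  classical
  induction k generalizing y μ with
  | zero =>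
    by_cases hθ : IsNonIdentity θ
    · obtain ⟨a, ha⟩ := exists_notMem_image hθ
      exact absurd ((h0 a).mp (Nat.le_zero.mp (hle a))) ha
    · obtain ⟨rfl, rfl⟩ := not_not.mp hθ
      exact ⟨.nil, rfl, trivial, rfl, fun a => (Nat.le_zero.mp (hle a)).symm⟩
  | succ k ih =>
    -- The image before the last letter. Truncated subtraction in `μ a - 1` merges levels `0` and
    -- `1`, as is right for the path without that letter.
    obtain ⟨z, f, hf⟩ := exists_image_eq {a | μ a ≤ 1}
    obtain ⟨e, rfl⟩ : ∃ e : z ⟶ y, f ≫ e = θ := exists_comp_eq fun a ha => by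
      rw [hf]
      exact ((h0 a).mpr ha).le.trans zero_le_one
    have hmem : ∀ a, a ∈ image f ↔ μ a ≤ 1 := fun a => Set.ext_iff.mp hf a
    obtain ⟨p, hp, hred, hlen, hμ⟩ := ih f (fun a => μ a - 1)
      (fun a => by rw [hmem]; omega) (fun a => by have := hle a; omega)
      (fun i hi => by
        obtain ⟨a, ha⟩ := hex (i + 1) (by omega)
        exact ⟨a, by omega⟩)
    have he : IsNonIdentity e := by
      rintro ⟨rfl, rfl⟩
      obtain ⟨a, ha⟩ := hex 0 (by omega)
      have h1 := (hmem a).mpr (by omega)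
      rw [eqToHom_refl, Category.comp_id] at h0
      have := (h0 a).mpr h1
      omega
    have hcomp : composePath (p.cons e) = f ≫ e := by rw [composePath_cons, hp]
    refine ⟨p.cons e, hcomp, ⟨hred, he⟩, by rw [Quiver.Path.length_cons, hlen], fun a => ?_⟩
    rw [missCount_cons, hμ, hcomp]
    have h1 := h0 a
    split_ifs with h
    · have := h1.mpr h
      omega
    · have : μ a ≠ 0 := fun h' => h (h1.mp h')
      omega

/-! ### Subdivision of factorizations -/

/-- `q` distinguishes all elements that `p` distinguishes, in the same order. -/
def MissRefines {y : PlusDeltaᵒᵖ} (p q : Quiver.Path x y) : Prop :=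
  ∀ a b, missCount p a < missCount p b → missCount q a < missCount q b

theorem missRefines_comp {y z : PlusDeltaᵒᵖ} {p q : Quiver.Path x y} (e : y ⟶ z)
    (w : Quiver.Path y z) (hpq : composePath p = composePath q) (hw : composePath w = e)
    (h : MissRefines p q) : MissRefines (p.cons e) (q.comp w) := by
  classical
  intro a b hab
  have hcomp : composePath (p.cons e) = composePath (q.comp w) := by
    rw [composePath_cons, composePath_comp, hpq, hw]
  rw [missCount_cons, missCount_cons] at hab
  -- Outside the common image, the levels grow by `1` and by the length of `w`, preserving the
  -- comparison. Inside it, the levels are at most these increments, hence below all levels outside.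
  by_cases ha : a ∈ image (composePath q) <;> by_cases hb : b ∈ image (composePath q)
  · rw [← hpq] at ha hb
    rw [(missCount_eq_zero_iff p a).mpr ha, (missCount_eq_zero_iff p b).mpr hb] at hab
    have ha' : a ∈ image (composePath (p.cons e)) := by
      by_contra h1
      rw [if_neg h1] at hab
      split_ifs at hab <;> omega
    have hb' : b ∉ image (composePath (p.cons e)) := by
      intro h1
      rw [if_pos h1] at hab
      omega
    rw [hcomp] at ha' hb'
    rw [(missCount_eq_zero_iff _ a).mpr ha']
    exact Nat.pos_of_ne_zero fun h1 => hb' ((missCount_eq_zero_iff _ b).mp h1)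
  · have h1 := missCount_comp_le q w ha
    have h2 := missCount_comp_of_notMem q w hb
    have h3 : missCount q b ≠ 0 := fun h1 => hb ((missCount_eq_zero_iff _ b).mp h1)
    omega
  · have ha' : a ∉ image (composePath (p.cons e)) := fun h1 =>
      ha (hpq ▸ image_comp_subset _ _ h1)
    rw [← hpq] at hb
    rw [(missCount_eq_zero_iff p b).mpr hb, if_neg ha'] at hab
    split_ifs at hab <;> omega
  · have ha' : a ∉ image (composePath (p.cons e)) := fun h1 =>
      ha (hpq ▸ image_comp_subset _ _ h1)
    have hb' : b ∉ image (composePath (p.cons e)) := fun h1 =>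
      hb (hpq ▸ image_comp_subset _ _ h1)
    rw [if_neg ha', if_neg hb'] at hab
    rw [missCount_comp_of_notMem q w ha, missCount_comp_of_notMem q w hb]
    have := h a b (by omega)
    omega

/-- `P` is a word of words with coarse word `p` and concatenation `q`. The endpoint is a variable
with an equation so that induction on `P` is possible. -/
theorem missRefines_of_path {b : Cat.FreeRefl PlusDeltaᵒᵖ}
    (P : Quiver.Path (Cat.FreeRefl.mk x) b) :
    ∀ {y : PlusDeltaᵒᵖ} (hb : b = Cat.FreeRefl.mk y) (p q : Quiver.Path x y),
      (wordEval PlusDeltaᵒᵖ).toPrefunctor.mapPath P = p.cast rfl (by rw [hb]; rfl) →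
      composePath P ≫ eqToHom hb = freeWord q → PathReduced q →
      composePath p = composePath q ∧ MissRefines p q := by
  induction P with
  | nil =>
    intro y hb p q hp hq hred
    obtain rfl : x = y := congrArg (wordEval PlusDeltaᵒᵖ).obj hb
    obtain rfl : Quiver.Path.nil = p := hp
    obtain rfl := isGrading.eq_nil hred
    exact ⟨rfl, fun a b h => h⟩
  | @cons c b P e ih =>
    intro y hb p q hp hq hred
    subst hb
    induction c with | _ z
    obtain ⟨w, hw, rfl⟩ := exists_freeWord e
    obtain ⟨q', hq', hPq'⟩ := exists_freeWord (composePath P)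
    obtain ⟨hcomp, hle⟩ := ih rfl ((wordEval PlusDeltaᵒᵖ).toPrefunctor.mapPath P) q' rfl
      (by rw [eqToHom_refl, Category.comp_id, hPq']) hq'
    obtain rfl : q'.comp w = q := by
      refine freeWord_injective ((pathReduced_comp _ _).mpr ⟨hq', hw⟩) hred ?_
      rw [← hq, eqToHom_refl, Category.comp_id, composePath_cons, freeWord_comp, hPq']
    obtain rfl : Quiver.Path.cons (V := PlusDeltaᵒᵖ) (a := x) (b := z) (c := y)
      ((wordEval PlusDeltaᵒᵖ).toPrefunctor.mapPath P)
      ((wordEval PlusDeltaᵒᵖ).map (freeWord w)) = p := hp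
    refine ⟨?_, missRefines_comp _ _ hcomp (wordEval_freeWord w).symm hle⟩
    exact (congrArg₂ (· ≫ ·) hcomp (wordEval_freeWord w)).trans (composePath_comp q' w).symm

theorem exists_path_of_missRefines {y : PlusDeltaᵒᵖ} (p q : Quiver.Path x y) (hp : PathReduced p)
    (hq : PathReduced q) (hcomp : composePath p = composePath q) (h : MissRefines p q) :
    ∃ P : Quiver.Path (Cat.FreeRefl.mk x) (Cat.FreeRefl.mk y),
      (wordEval PlusDeltaᵒᵖ).toPrefunctor.mapPath P = p ∧ composePath P = freeWord q := by
  classical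
  induction p with
  | nil =>
    obtain rfl := isGrading.eq_nil hq
    exact ⟨.nil, rfl, (freeWord_nil x).symm⟩
  | @cons z y p e ih =>
    let S : Finset (Fin x.unop.card) := Finset.univ.filter fun a => a ∈ image (composePath p)
    have hS : ∀ a, a ∈ S ↔ missCount (p.cons e) a ≤ 1 := fun a => by
      simp [S, mem_image_iff_missCount_cons_le p e]
    have hzero : ∀ a, missCount q a = 0 ↔ missCount (p.cons e) a = 0 := fun a => by
      rw [missCount_eq_zero_iff, missCount_eq_zero_iff, hcomp]
    -- `S` is the image before the last letter of `p`. Refinement puts all elements outside `S`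
    -- above level `t` of `q`, so `S` is also the image just before the last `t` letters of `q`;
    -- those letters compose to the last letter of `p`.
    let t := S.sup (missCount q)
    have ht : ∀ a, a ∈ S ↔ missCount q a ≤ t := by
      intro a
      refine ⟨fun ha => Finset.le_sup ha, fun ha => ?_⟩
      by_contra haS
      have h1 : ¬ missCount (p.cons e) a ≤ 1 := fun h1 => haS ((hS a).mpr h1)
      have h2 : missCount q a ≠ 0 := fun h2 => by
        have := (hzero a).mp h2
        omega
      have h3 : t < missCount q a := (Finset.sup_lt_iff (Nat.pos_of_ne_zero h2)).mpr fun b hb => by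
        have := (hS b).mp hb
        exact h b a (by omega)
      omega
    have htq : t ≤ q.length := Finset.sup_le fun a _ => missCount_le_length q a
    obtain ⟨z', q₁, q₂, rfl, hlen⟩ := q.exists_eq_comp_of_le_length (n := q.length - t)
      (Nat.sub_le _ _)
    have hlen₂ : q₂.length = t := by
      rw [Quiver.Path.length_comp] at hlen htq
      omega
    have him : image (composePath p) = image (composePath q₁) := by
      ext a
      rw [mem_image_iff_missCount_comp_le q₁ q₂, hlen₂, ← ht]
      simp [S]
    obtain rfl := obj_eq_of_image_eq him
    have hpq := hom_eq_of_image_eq him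
    have hcomp' := hcomp
    rw [composePath_cons, composePath_comp, hpq] at hcomp'
    obtain rfl := comp_left_cancel hcomp'
    obtain ⟨hq₁, hq₂⟩ := (pathReduced_comp _ _).mp hq
    obtain ⟨P, hP, hP'⟩ := ih q₁ hp.1 hq₁ hpq fun a b hab => by
      have hb : b ∉ image (composePath p) := fun hb => by
        rw [(missCount_eq_zero_iff p b).mpr hb] at hab
        omega
      have hb' : b ∉ image (composePath q₁) := him ▸ hb
      by_cases ha : a ∈ image (composePath p)
      · rw [(missCount_eq_zero_iff q₁ a).mpr (him ▸ ha)]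
        exact Nat.pos_of_ne_zero fun h0 => hb' ((missCount_eq_zero_iff q₁ b).mp h0)
      · have ha' : a ∉ image (composePath q₁) := him ▸ ha
        have h1 : ∀ c, c ∉ image (composePath p) →
            missCount (p.cons (composePath q₂)) c = missCount p c + 1 := fun c hc =>
          missCount_comp_of_notMem p (composePath q₂).toPath hc
        have h2 := h a b (by rw [h1 a ha, h1 b hb]; omega)
        rw [missCount_comp_of_notMem _ _ ha', missCount_comp_of_notMem _ _ hb'] at h2
        omega
    refine ⟨P.cons (freeWord q₂), ?_, ?_⟩
    · rw [Prefunctor.mapPath_cons, hP]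
      exact congrArg (Quiver.Path.cons p) (wordEval_freeWord q₂)
    · rw [composePath_cons, hP', freeWord_comp]

theorem isSubdivision_iff {y : PlusDeltaᵒᵖ} {p q : Quiver.Path x y} (hp : PathReduced p)
    (hq : PathReduced q) (hcomp : composePath p = composePath q) :
    IsSubdivision (pathToFree p) (pathToFree q) ↔ MissRefines p q := by
  constructor
  · rintro ⟨⟨a, b, f⟩, h1, h2⟩
    induction a with | _ a
    induction b with | _ b
    obtain rfl : a = Cat.FreeRefl.mk x := congrArg Comma.left h2
    obtain rfl : b = Cat.FreeRefl.mk y := congrArg Comma.right h2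
    obtain ⟨P, hP, rfl⟩ := exists_freeWord f
    refine (missRefines_of_path P rfl p q ?_ ?_ hq).2
    · refine freeWord_injective (IsGrading.pathReduced_mapPath
        (r := fun x : PlusDeltaᵒᵖ => x.unop.card) (F := wordEval PlusDeltaᵒᵖ) isGrading.freeRefl hP) hp ?_
      rw [← wordMap_freeWord]
      exact (Arrow.mk_inj _ _).mp h1
    · rw [eqToHom_refl, Category.comp_id, ← wordEval_freeWord]
      exact (Arrow.mk_inj _ _).mp h2
  · intro h
    obtain ⟨P, hP, hP'⟩ := exists_path_of_missRefines p q hp hq hcomp h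
    refine ⟨Arrow.mk (freeWord P), ?_, ?_⟩
    · refine congrArg Arrow.mk ((wordMap_freeWord _ P).trans ?_)
      rw [hP]
      rfl
    · exact congrArg Arrow.mk ((wordEval_freeWord P).trans hP')

end MissCount

/-! ### The triangulation of the permutahedron -/

section Triangulation

variable {j m : PlusDelta} (θ : op j ⟶ op m)

theorem nonempty_orderIso_compl_range : Nonempty (Fin (j.card - m.card) ≃o
    {a : Fin j.card // a ∉ Set.range (PlusDelta.emb θ.unop)}) := by
  classical
  have h1 : Fintype.card {a : Fin j.card // a ∉ Set.range (PlusDelta.emb θ.unop)} =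
      j.card - m.card := by
    rw [Fintype.card_subtype_compl]
    have h2 := Set.card_range_of_injective (PlusDelta.emb θ.unop).injective
    simp only [Fintype.card_fin] at h2 ⊢
    exact congrArg (j.card - ·) h2
  exact ⟨Fintype.orderIsoFinOfCardEq _ h1⟩

variable {θ}
variable (Q : Fin (j.card - m.card) ≃o {a : Fin j.card // a ∉ Set.range (PlusDelta.emb θ.unop)})

theorem missCount_eq_zero_of_mem (φ : Factorization θ) {a : Fin j.card}
    (ha : a ∈ Set.range (PlusDelta.emb θ.unop)) : missCount φ.1 a = 0 :=
  (missCount_eq_zero_iff φ.1 a).mpr (by rw [φ.2.1]; exact ha)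

theorem missCount_ne_zero (φ : Factorization θ)
    (a : {a : Fin j.card // a ∉ Set.range (PlusDelta.emb θ.unop)}) : missCount φ.1 a.1 ≠ 0 :=
  fun h => a.2 (by have := (missCount_eq_zero_iff φ.1 a.1).mp h; rw [φ.2.1] at this; exact this)

/-- The ordered partition of the complement of the image of `θ` given by a factorization. -/
def Factorization.partition (φ : Factorization θ) : OrderedPartition (j.card - m.card) where
  blocks := φ.1.length
  block a := ⟨missCount φ.1 (Q a).1 - 1, by
    have h1 := missCount_le_length φ.1 (Q a).1
    have h2 := missCount_ne_zero φ (Q a)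
    omega⟩
  surjective i := by
    obtain ⟨a, ha⟩ := exists_missCount_eq φ.1 φ.2.2 i.2
    have h1 : a ∉ Set.range (PlusDelta.emb θ.unop) := fun h => by
      rw [missCount_eq_zero_of_mem φ h] at ha
      omega
    refine ⟨Q.symm ⟨a, h1⟩, Fin.ext ?_⟩
    simp only [OrderIso.apply_symm_apply, ha, Nat.add_sub_cancel]

theorem Factorization.partition_block (φ : Factorization θ) (a : Fin (j.card - m.card)) :
    ((φ.partition Q).block a : ℕ) + 1 = missCount φ.1 (Q a).1 :=
  Nat.sub_add_cancel (Nat.pos_of_ne_zero (missCount_ne_zero φ (Q a)))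

theorem Factorization.partition_injective :
    Function.Injective (Factorization.partition (θ := θ) Q) := by
  intro φ ψ h
  refine Subtype.ext (eq_of_missCount_eq φ.2.2 ψ.2.2 (φ.2.1.trans ψ.2.1.symm) fun a => ?_)
  by_cases ha : a ∈ Set.range (PlusDelta.emb θ.unop)
  · rw [missCount_eq_zero_of_mem φ ha, missCount_eq_zero_of_mem ψ ha]
  · have h1 := φ.partition_block Q (Q.symm ⟨a, ha⟩)
    have h2 := ψ.partition_block Q (Q.symm ⟨a, ha⟩)
    rw [h] at h1
    rw [OrderIso.apply_symm_apply] at h1 h2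
    exact h1.symm.trans h2

theorem Factorization.partition_surjective :
    Function.Surjective (Factorization.partition (θ := θ) Q) := by
  classical
  intro P
  obtain ⟨p, hp, hred, -, hμ⟩ := exists_path_of_levels P.blocks θ
    (fun a => if h : a ∉ Set.range (PlusDelta.emb θ.unop) then
      (P.block (Q.symm ⟨a, h⟩) : ℕ) + 1 else 0)
    (fun a => by
      by_cases h : a ∈ Set.range (PlusDelta.emb θ.unop)
      · rw [dif_neg (not_not.mpr h)]
        exact ⟨fun _ => h, fun _ => rfl⟩
      · rw [dif_pos h]
        exact ⟨fun h1 => absurd h1 (Nat.succ_ne_zero _), fun h1 => absurd h1 h⟩)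
    (fun a => by
      split_ifs
      · exact Nat.zero_le _
      · exact (P.block _).2)
    (fun i hi => by
      obtain ⟨a, ha⟩ := P.surjective ⟨i, hi⟩
      refine ⟨(Q a).1, ?_⟩
      rw [dif_pos (Q a).2, Subtype.coe_eta, OrderIso.symm_apply_apply, ha])
  refine ⟨⟨p, hp, hred⟩, ?_⟩
  have key : ∀ a, ((Factorization.partition Q ⟨p, hp, hred⟩).block a : ℕ) = P.block a := by
    intro a
    have h1 := Factorization.partition_block Q (⟨p, hp, hred⟩ : Factorization θ) a
    rw [hμ, dif_pos (Q a).2, Subtype.coe_eta, OrderIso.symm_apply_apply] at h1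
    exact Nat.succ_injective h1
  -- Antisymmetry of refinement avoids transport along an equality of the numbers of blocks.
  refine le_antisymm (OrderedPartition.le_iff.mpr fun a b hab => ?_)
    (OrderedPartition.le_iff.mpr fun a b hab => ?_)
  · rwa [Fin.lt_def, ← key, ← key]
  · rwa [Fin.lt_def, key, key]

/-- The factorizations of `θ` are the ordered partitions of the complement of its image. -/
noncomputable def Factorization.partitionEquiv :
    Factorization θ ≃ OrderedPartition (j.card - m.card) :=
  Equiv.ofBijective _ ⟨Factorization.partition_injective Q, Factorization.partition_surjective Q⟩

/-- Elements of the image of `θ` have level `0` in every factorization and all others have positive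
level, so comparisons within the complement suffice. -/
theorem Factorization.partition_le_iff (φ ψ : Factorization θ) :
    φ.partition Q ≤ ψ.partition Q ↔ MissRefines φ.1 ψ.1 := by
  rw [OrderedPartition.le_iff]
  have hlt : ∀ (φ : Factorization θ) a b, (φ.partition Q).block a < (φ.partition Q).block b ↔
      missCount φ.1 (Q a).1 < missCount φ.1 (Q b).1 := fun φ a b => by
    rw [← partition_block, ← partition_block, Fin.lt_def]
    omega
  simp only [hlt]
  refine ⟨fun h a b hab => ?_, fun h a b => h _ _⟩
  have hb : b ∉ Set.range (PlusDelta.emb θ.unop) := fun hb => by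
    rw [missCount_eq_zero_of_mem φ hb] at hab
    omega
  by_cases ha : a ∈ Set.range (PlusDelta.emb θ.unop)
  · rw [missCount_eq_zero_of_mem ψ ha]
    exact Nat.pos_of_ne_zero (missCount_ne_zero ψ ⟨b, hb⟩)
  · have := h (Q.symm ⟨a, ha⟩) (Q.symm ⟨b, hb⟩)
    simp only [OrderIso.apply_symm_apply] at this
    exact this hab

theorem isOrderComplex_DKComponent
    (V : Factorization θ ≃ (DKComponent θ).toSSet.obj (op (SimplexCategory.mk 0)))
    (hV : ∀ φ, (V φ).1.1 = pathToFree φ.1) :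
    IsOrderComplex (fun v => Factorization.partition Q (V.symm v)) where
  ext n s s' h := PlusDelta.isGrading.simplex_ext s s' fun i =>
    V.symm.injective (Factorization.partition_injective Q (h i))
  mono n s i k hik := by
    have h := isSubdivision_simplexVertex s i k hik
    obtain ⟨φ, hφ⟩ := V.surjective (simplexVertex s i)
    obtain ⟨ψ, hψ⟩ := V.surjective (simplexVertex s k)
    dsimp only
    rw [← hφ, ← hψ, Equiv.symm_apply_apply, Equiv.symm_apply_apply,
      Factorization.partition_le_iff]
    rw [← hφ, ← hψ, hV, hV] at h
    exact (isSubdivision_iff φ.2.2 ψ.2.2 (φ.2.1.trans ψ.2.1.symm)).mp h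
  exists_of_monotone n c hc := by
    choose φ hφ using fun i => Factorization.partition_surjective Q (c i)
    obtain ⟨s, hs⟩ := PlusDelta.isGrading.exists_simplex (fun i => V (φ i)) fun i => by
      rw [hV, hV]
      refine (isSubdivision_iff (φ i.castSucc).2.2 (φ i.succ).2.2
        ((φ i.castSucc).2.1.trans (φ i.succ).2.1.symm)).mpr ?_
      rw [← Factorization.partition_le_iff Q, hφ, hφ]
      exact hc (Fin.castSucc_le_succ i)
    exact ⟨s, fun i => by rw [hs, Equiv.symm_apply_apply, hφ]⟩

end Triangulation

theorem simplexVertex_zero {K : SSet.{0}} (v : K.obj (op (SimplexCategory.mk 0))) (i : Fin 1) :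
    simplexVertex (n := 0) v i = v := by
  have h : (SimplexCategory.const (SimplexCategory.mk 0) (SimplexCategory.mk 0) i).op = 𝟙 _ :=
    Quiver.Hom.unop_inj (Subsingleton.elim _ _)
  rw [simplexVertex, h, K.map_id]
  rfl

/-- The realization of the order complex of the poset of ordered partitions is homeomorphic to the
permutahedron, a vertex being sent to the barycentre of the face. -/
theorem IsOrderComplex.exists_homeomorph_permutahedron {K : SSet.{0}} {n : ℕ}
    {e : K.obj (op (SimplexCategory.mk 0)) → OrderedPartition n} (hK : IsOrderComplex e)
    {x : Fin n → ℝ} (hx : Function.Injective x) :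
    ∃ h : SSet.toTop.obj K ≃ₜ permutahedron x, IsTriangulation h ∧
      ∀ v, (h (vertexPoint v) : Fin n → ℝ) = (e v).barycenter x := by
  obtain ⟨h, hT, hh⟩ := hK.exists_homeomorph (P := permutahedron x) (convex_convexHull ℝ _)
    (fun P => P.barycenter x) (fun P => P.barycenter_mem hx)
    (fun y hy => exists_flag_weights hx y (slack_nonneg_of_mem hy) (slack_univ_of_mem hy))
    -- Equal points have equal slacks, and the zero sets of the slacks of the barycentres recover
    -- refinement, as uniqueness of weights requires.
    (fun t w ht hw htc hwc ht1 hw1 htw =>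
      weights_unique (fun P U => slack x (P.barycenter x) U)
        (fun P U => slack_nonneg_of_mem (P.barycenter_mem hx) U)
        (fun P R => by
          simp only [OrderedPartition.slack_barycenter_eq_zero_iff hx]
          exact ⟨OrderedPartition.le_of_isUpper, fun h U hU => hU.mono h⟩)
        t w ht hw htc hwc (ht1.trans hw1.symm) fun U => by
          rw [← slack_sum _ _ ht1, ← slack_sum _ _ hw1, htw])
  refine ⟨h, hT, fun v => ?_⟩
  refine (hh 0 v (stdSimplex.vertex 0)).trans ?_
  rw [Fin.sum_univ_one, simplexVertex_zero]
  simp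

theorem proposition4p2 (j m : PlusDelta) :
    -- the mapping space is the disjoint union of its parts `DKComponent θ`
    Nonempty (Limits.IsColimit (Limits.Cofan.mk (DKMap (op j) (op m))
      fun θ : op j ⟶ op m => (DKComponent θ).ι)) ∧
    ∀ θ : op j ⟶ op m,
      ∃ (Q : Fin (j.card - m.card) ≃o
            {a : Fin j.card // a ∉ Set.range (PlusDelta.emb θ.unop)})
        (V : Factorization θ ≃ (DKComponent θ).toSSet.obj (op (SimplexCategory.mk 0)))
        (B : Factorization θ ≃ OrderedPartition (j.card - m.card)),
        -- the vertices are the factorizations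
        (∀ φ, (V φ).1.1 = pathToFree φ.1) ∧
        -- the factorizations are the ordered partitions of the complement of the image of `θ`
        (∀ φ, (B φ).blocks = φ.1.length) ∧
        (∀ φ a, ((B φ).block a : ℕ) + 1 = missCount φ.1 (Q a).1) ∧
        ∀ x : Fin (j.card - m.card) → ℝ, Function.Injective x →
          Module.finrank ℝ (vectorSpan ℝ (permutahedron x)) = j.card - m.card - 1 ∧
          -- the ordered partitions are the nonempty faces
          Set.BijOn (fun P : OrderedPartition (j.card - m.card) => P.face x) Set.univ
            {F | F.Nonempty ∧ IsExposed ℝ (permutahedron x) F} ∧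
          (∀ P : OrderedPartition (j.card - m.card),
            Module.finrank ℝ (vectorSpan ℝ (P.face x)) + P.blocks = j.card - m.card) ∧
          -- the triangulation
          ∃ h : SSet.toTop.obj (DKComponent θ).toSSet ≃ₜ permutahedron x,
            IsTriangulation h ∧
            (∀ φ, (h (vertexPoint (V φ)) : Fin (j.card - m.card) → ℝ) = (B φ).barycenter x) ∧
            ∀ (n : ℕ) (s : (DKComponent θ).toSSet.obj (op (SimplexCategory.mk n)))
              (i k : Fin (n + 1)), i ≤ k →
              (B (V.symm (simplexVertex s k))).face x ⊆
                (B (V.symm (simplexVertex s i))).face x := by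
  refine ⟨nonempty_isColimit_DKComponent _ _, fun θ => ?_⟩
  obtain ⟨Q⟩ := nonempty_orderIso_compl_range θ
  obtain ⟨V, hV⟩ := exists_vertexEquiv θ
  have hK := isOrderComplex_DKComponent Q V hV
  refine ⟨Q, V, Factorization.partitionEquiv Q, hV, fun φ => rfl,
    fun φ a => φ.partition_block Q a, fun x hx => ⟨finrank_permutahedron hx,
    OrderedPartition.bijOn_face hx, fun P => OrderedPartition.finrank_face hx P, ?_⟩⟩
  obtain ⟨h, hT, hv⟩ := hK.exists_homeomorph_permutahedron hx
  refine ⟨h, hT, fun φ => ?_, fun n s i k hik => OrderedPartition.face_anti hx (hK.mono n s hik)⟩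
  rw [hv, Equiv.symm_apply_apply]
  rfl
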